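/- **Model.** Let $\mathcal H$ be a finite set of $K\ge 2$ hypotheses, $\mathcal A$ a finite set of actions, and let $P_h^a$ ($h\in\mathcal H$, $a\in\mathcal A$) be probability distributions on a measurable space with densities $p_a(\cdot\mid h)$ with respect to reference measures $\mu_a$. Assume that all divergences $d_a(h,g)=\mathrm{KL}(P_h^a\,\|\,P_g^a)$ are finite and that for all $h\ne g$ some $a$ has $d_a(h,g)>0$. Let $h^*$ be the true hypothesis and assume that, for some $v\ge 0$, for all $a$, all $g\neq h^*$ and all $\lambda\in\mathbb R$, $$\mathbb E_{O\sim P_{h^*}^a}\exp\Bigl(\lambda\Bigl(\log\tfrac{p_a(O\mid h^*)}{p_a(O\mid g)}-d_a(h^*,g)\Bigr)\Bigr)\le e^{\lambda^2v/2}.$$ For nonempty $S\subseteq\mathcal H\setminus\{h\}$ and $w$ in the simplex $\Delta(\mathcal A)$ put $f_S(w;h)=\min_{g\in S}\sum_a w_a d_a(h,g)$, and let $D_0=\max_{w\in\Delta(\mathcal A)} f_{\mathcal H\setminus\{h^*\}}(w;h^*)$. **Algorithm.** Fix $b,c>0$ and $\eta\in[0,1]$. For $\alpha\in(0,1]$ and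 $\delta\in(0,1)$ put $L=\log(1/\delta)$ and $\beta(t)=\alpha L+b\log t+c$. In round $t\ge1$ an action $A_t$ is chosen from the past and $O_t$ is drawn from $P_{h^*}^{A_t}$. Let $N_a(t)$ be the number of selections of $a$ in rounds $1,\dots,t$, let $L_t(h)=\sum_{k=1}^t\log p_{A_k}(O_k\mid h)$ and $Z_t(h,g)=L_t(h)-L_t(g)$, let $\hat h(t)$ be a maximizer of $L_t$ (with $\hat h(0)$ arbitrary), and let $$G_t(i)=\{g\ne i:\ Z_s(i,g)<\beta(s)\text{ for all }1\le s\le t\text{ with }\hat h(s)=i\},\qquad \tau=\inf\{t\ge1:\ G_t(\hat h(t))=\emptyset\}.$$ For $t<\tau$ let $u(t)$ be a maximizer of $f_{G_t(\hat h(t))}(\cdot\,;\hat h(t))$ over $\Delta(\mathcal A)$, let $\tilde u(t)$ be an $\ell^\infty$-projection of $u(t)$ onto $\{w\in\Delta(\mathcal A):w_a\ge\varepsilon_t\ \forall a\}$ with $\varepsilon_t=\eta/(2\sqrt{|\mathcal A|^2+t})$, and let $A_{t+1}$ be a maximizer of $a\mapsto\sum_{s=1}^t\tilde u_a(s)-N_a(t)$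 (C-Tracking). All ties are broken arbitrarily on the basis of the past. **Chains.** An elimination chain $\sigma$ is a sequence $\mathcal H\setminus\{h^*\}=S_0\supseteq S_1\supseteq\dots\supseteq S_m=\emptyset$. Its chain event $\mathcal E_\sigma$ consists of the sample paths on which $\tau<\infty$, $\hat h(\tau)=h^*$, and there are times $0=T_0<T_1<\dots<T_m=\tau$ with $G_t(h^*)=S_k$ for $T_k\le t<T_{k+1}$, $k=0,\dots,m-1$. **Claim.** For every elimination chain $\sigma$ there are constants $C_{1,\sigma},C_{2,\sigma},\widetilde C_{3,\sigma}>0$, independent of $\alpha$, $\delta$ and of the tie-breaking, such that for all $\alpha\in(0,1]$ and $\delta\in(0,1)$ $$\mathbb E[\tau\mathbf 1_{\mathcal E_\sigma}]\le\Pr(\mathcal E_\sigma)\Bigl[\frac{\alpha L}{D_0}+\frac b{D_0}\log(e+L)+C_{1,\sigma}\sqrt{L\log(e+L)}+C_{2,\sigma}\log^2(e+L)\Bigr]+\widetilde C_{3,\sigma}.$$ -/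

import Mathlib

open MeasureTheory ProbabilityTheory InformationTheory
open scoped NNReal ENNReal

namespace ElimTaS

noncomputable section

/-- An active multi-hypothesis sensing model: hypotheses `H`, sensing actions `A`, observations in
`O`. Under action `a` and hypothesis `h` the observation has the probability density `dens a h`
with respect to the reference measure `ref a`, which is common to all hypotheses. -/
structure SensingModel (H A O : Type*) [MeasurableSpace O] where
  ref : A → Measure O
  dens : A → H → O → ℝ
  dens_nonneg : ∀ a h o, 0 ≤ dens a h o
  measurable_dens : ∀ a h, Measurable (dens a h)
  lintegral_dens : ∀ a h, ∫⁻ o, ENNReal.ofReal (dens a h o) ∂(ref a) = 1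

variable {H A O : Type*} [MeasurableSpace O]

/-- The observation distribution `P_h^a`. -/
def SensingModel.obsLaw (M : SensingModel H A O) (a : A) (h : H) : Measure O :=
  (M.ref a).withDensity fun o => ENNReal.ofReal (M.dens a h o)

instance (M : SensingModel H A O) (a : A) (h : H) : IsProbabilityMeasure (M.obsLaw a h) :=
  ⟨by rw [SensingModel.obsLaw, withDensity_apply _ MeasurableSet.univ, Measure.restrict_univ,
    M.lintegral_dens]⟩

/-- All divergences between observation distributions are finite. -/
def SensingModel.FiniteKL (M : SensingModel H A O) : Prop :=
  ∀ a h g, klDiv (M.obsLaw a h) (M.obsLaw a g) ≠ ⊤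

/-- The action-wise divergence `d_a(h, g) = KL(P_h^a ‖ P_g^a)`, as a real number. -/
def SensingModel.div (M : SensingModel H A O) (a : A) (h g : H) : ℝ :=
  (klDiv (M.obsLaw a h) (M.obsLaw a g)).toReal

/-- Any two distinct hypotheses are distinguished by at least one action. -/
def SensingModel.Identifiable (M : SensingModel H A O) : Prop :=
  ∀ h g, h ≠ g → ∃ a, 0 < M.div a h g

/-- Under the true hypothesis `h₀`, for every action, the log-likelihood ratio of `h₀` against any
other hypothesis, centred at its mean, is sub-Gaussian with variance proxy `v`. -/
def SensingModel.SubGaussianAt (M : SensingModel H A O) (h₀ : H) (v : ℝ≥0) : Prop :=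
  ∀ a g, g ≠ h₀ →
    HasSubgaussianMGF (fun o => Real.log (M.dens a h₀ o / M.dens a g o) - M.div a h₀ g) v
      (M.obsLaw a h₀)

section Oracle

variable [Fintype A]

/-- The worst-case information rate `f_S(w; h) = min_{g ∈ S} ∑_a w_a d_a(h, g)`, for `S` nonempty. -/
def SensingModel.infoRate (M : SensingModel H A O) (h : H) (S : Finset H) (w : A → ℝ) : ℝ :=
  ⨅ g : S, ∑ a, w a * M.div a h g

/-- The set of maximizers `w^*(h; S)` of the worst-case information rate over the simplex. -/
def SensingModel.oracleAllocations (M : SensingModel H A O) (h : H) (S : Finset H) :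
    Set (A → ℝ) :=
  {w | w ∈ stdSimplex ℝ A ∧ IsMaxOn (M.infoRate h S) (stdSimplex ℝ A) w}

/-- The oracle information rate `D^*(h; S) = max_{w ∈ Δ(A)} f_S(w; h)`. -/
def SensingModel.oracleRate (M : SensingModel H A O) (h : H) (S : Finset H) : ℝ :=
  sSup (M.infoRate h S '' stdSimplex ℝ A)

/-- The allocations that give each action a weight of at least `ε`. -/
def flooredSimplex (A : Type*) [Fintype A] (ε : ℝ) : Set (A → ℝ) :=
  {w | w ∈ stdSimplex ℝ A ∧ ∀ a, ε ≤ w a}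

/-- The `ℓ^∞`-projections of `u` onto the allocations with all weights at least `ε` (for `ε = 0` and
`u` in the simplex the only one is `u`). -/
def flooredProjections (ε : ℝ) (u : A → ℝ) : Set (A → ℝ) :=
  {w | w ∈ flooredSimplex A ε ∧ ∀ w' ∈ flooredSimplex A ε, ‖w - u‖ ≤ ‖w' - u‖}

/-- The exploration floor `η / (2 √(|A|² + t))` of C-Tracking in round `t`. -/
def explorationFloor (A : Type*) [Fintype A] (η : ℝ) (t : ℕ) : ℝ :=
  η / (2 * Real.sqrt ((Fintype.card A : ℝ) ^ 2 + t))

end Oracle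

/-- The opponents `H \ {i}` of a candidate `i`. -/
def opponents [Fintype H] (i : H) : Finset H :=
  open Classical in Finset.univ.filter fun g => g ≠ i

/-- The elimination threshold `β_elim(t, δ) = α log (1/δ) + b log t + c`. -/
def elimThreshold (b c α δ : ℝ) (t : ℕ) : ℝ :=
  α * Real.log (1 / δ) + (b * Real.log t + c)

/-- One sample path: the actions `A_t` and observations `O_t` for `t ≥ 1`, the champions `ĥ(t)`
for `t ≥ 0`, the oracle allocations `u(t)`, and the allocations `target t` that are tracked. -/
structure Path (H A O : Type*) where
  act : ℕ → A
  obs : ℕ → O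
  champ : ℕ → H
  oracle : ℕ → A → ℝ
  target : ℕ → A → ℝ

/-- The cumulative log-likelihood `L_t(h)`. -/
def logLik (M : SensingModel H A O) (x : Path H A O) (t : ℕ) (h : H) : ℝ :=
  ∑ k ∈ Finset.Icc 1 t, Real.log (M.dens (x.act k) h (x.obs k))

/-- The pairwise log-likelihood ratio `Z_t(h, g) = L_t(h) - L_t(g)`. -/
def llRatio (M : SensingModel H A O) (x : Path H A O) (t : ℕ) (h g : H) : ℝ :=
  logLik M x t h - logLik M x t g

/-- The number `N_a(t)` of selections of action `a` in rounds `1, …, t`. -/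
def actCount (x : Path H A O) (t : ℕ) (a : A) : ℕ :=
  open Classical in ((Finset.Icc 1 t).filter fun s => x.act s = a).card

/-- The cumulative target `∑_{s=1}^t target_a(s)`. -/
def cumTarget (x : Path H A O) (t : ℕ) (a : A) : ℝ :=
  ∑ s ∈ Finset.Icc 1 t, x.target s a

/-- The active-opponent set `G_t(i)` for the elimination threshold `β`, after the update of
round `t`. -/
def activeSet [Fintype H] (M : SensingModel H A O) (β : ℕ → ℝ) (x : Path H A O) (t : ℕ) (i : H) :
    Finset H :=
  open Classical in
  (opponents i).filter fun g =>
    ∀ s, 1 ≤ s → s ≤ t → x.champ s = i → llRatio M x s i g < β s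

/-- The stopping time `τ`: the first round after which the active-opponent set of the champion is
empty (`⊤` if there is none). -/
def stopTime [Fintype H] (M : SensingModel H A O) (β : ℕ → ℝ) (x : Path H A O) : ℕ∞ :=
  ⨅ (t : ℕ) (_ : 1 ≤ t ∧ activeSet M β x t (x.champ t) = ∅), (t : ℕ∞)

/-- The rules of Track-and-Stop with adaptive elimination on one sample path. They bind the
sampling only up to the stopping time; all ties are broken arbitrarily. -/
structure FollowsElimTaS [Fintype H] [Fintype A] (M : SensingModel H A O) (β : ℕ → ℝ) (η : ℝ)
    (x : Path H A O) : Prop where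
  /-- the champion maximizes the likelihood -/
  champ_mle : ∀ t, 1 ≤ t → ∀ h, logLik M x t h ≤ logLik M x t (x.champ t)
  /-- `u(t)` is an oracle allocation of the champion against its active opponents -/
  oracle_mem : ∀ t : ℕ, (t : ℕ∞) < stopTime M β x →
    x.oracle t ∈ M.oracleAllocations (x.champ t) (activeSet M β x t (x.champ t))
  /-- the tracked allocation is `u(t)`, projected to respect the exploration floor -/
  target_mem : ∀ t : ℕ, (t : ℕ∞) < stopTime M β x →
    x.target t ∈ flooredProjections (explorationFloor A η t) (x.oracle t)
  /-- C-Tracking: the next action is a most under-represented one -/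
  track : ∀ t : ℕ, (t : ℕ∞) < stopTime M β x → ∀ a,
    cumTarget x t a - actCount x t a ≤
      cumTarget x t (x.act (t + 1)) - actCount x t (x.act (t + 1))

/-- `X` is a run of the algorithm when `h₀` is the true hypothesis: `ℱ t` is the information
available after `t` rounds, the next action is chosen on its basis, and given `ℱ t` the next
observation has the law of the chosen action under `h₀`. -/
structure IsElimTaSRun [Fintype H] [Fintype A] (M : SensingModel H A O) (h₀ : H) (β : ℕ → ℝ)
    (η : ℝ) {Ω : Type*} {mΩ : MeasurableSpace Ω} (P : Measure Ω) (ℱ : Filtration ℕ mΩ)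
    (X : Ω → Path H A O) : Prop where
  follows : ∀ᵐ ω ∂P, FollowsElimTaS M β η (X ω)
  champ_adapted : ∀ t h, MeasurableSet[ℱ t] {ω | (X ω).champ t = h}
  act_predictable : ∀ t a, MeasurableSet[ℱ t] {ω | (X ω).act (t + 1) = a}
  obs_adapted : ∀ t, Measurable[ℱ (t + 1)] fun ω => (X ω).obs (t + 1)
  obs_law : ∀ t a (F : Set Ω) (B : Set O), MeasurableSet[ℱ t] F → MeasurableSet B →
    P (F ∩ {ω | (X ω).act (t + 1) = a} ∩ {ω | (X ω).obs (t + 1) ∈ B}) =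
      P (F ∩ {ω | (X ω).act (t + 1) = a}) * M.obsLaw a h₀ B

/-- A deterministic elimination chain `S_0 ⊇ S_1 ⊇ ⋯ ⊇ S_m = ∅` of opponents of `h₀`, with
`S_0 = H \ {h₀}`; several opponents may leave in one transition. -/
structure ElimChain [Fintype H] (h₀ : H) where
  len : ℕ
  stage : ℕ → Finset H
  stage_zero : stage 0 = opponents h₀
  stage_anti : ∀ k < len, stage (k + 1) ⊆ stage k
  stage_len : stage len = ∅

/-- The sample path `x` belongs to the chain event of `σ`: it stops with output `h₀`, and there are
transition times `0 = T_0 < T_1 < ⋯ < T_m = τ` such that the active-opponent set of `h₀` is `S_k`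
from the update of round `T_k` until the update of round `T_{k+1}`. -/
def OnChain [Fintype H] (M : SensingModel H A O) {h₀ : H} (σ : ElimChain h₀) (β : ℕ → ℝ)
    (x : Path H A O) : Prop :=
  ∃ T : ℕ → ℕ, T 0 = 0 ∧ (∀ k < σ.len, T k < T (k + 1)) ∧
    stopTime M β x = (T σ.len : ℕ∞) ∧ x.champ (T σ.len) = h₀ ∧
    ∀ k < σ.len, ∀ t, T k ≤ t → t < T (k + 1) → activeSet M β x t h₀ = σ.stage k

end

end ElimTaS

/-! The chain structure plays no role in the estimate: `lintegral_indicator_le_of_ae_le` works for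
an arbitrary set `E`, measurable or not. What matters are two pathwise bounds on `τ`, both with an
additive error `C * R`, where `R` is a random time after which all centred log-likelihood ratios of
`h₀` are `O(√(t log (e + t)))`. The mean of `R` is bounded in terms of the number of hypotheses
only, so this error goes into the additive constant and is not multiplied by `P E`.

Sharp bound, off the event `F` that some hypothesis ever leads `h₀` by `αL` in log-likelihood. There
`h₀` is never eliminated by a wrong champion `i`, so in rounds with champion `i` the sampling
separates `i` from `h₀`. Since `i` is a likelihood maximizer, only `O(√(t log t))` such information
can have accumulated, hence there are few such rounds. In rounds with champion `h₀` the oracle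
allocation is computed against a subset of all opponents, so its rate is at least `D₀`, and an
opponent still active at the last such round has collected at most the threshold plus noise
(`exists_oracleRate_mul_round_le`).

Crude bound, on every path with finite `R`: each champion still has an active opponent, and
information separating these two also separates `h₀` from one of them, so the number of rounds is of
the order of the threshold (`exists_round_le`).

By Ville's inequality `P F ≤ |H| exp (-αL)`, and `x exp (-x) ≤ 1` turns the crude `O(αL)` on `F`
into a constant. All path arguments hold for any tie-breaking. -/

namespace ElimTaS

/-! ### Adaptive sampling: exponential moments of additive functionals and Ville's inequality -/

section Sampling

/-- The additive functional `∑_{k ≤ t} ξ(A_k, O_k)` of a sample path. -/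
noncomputable def pathSum {H A O : Type*} (ξ : A → O → ℝ) (x : Path H A O) (t : ℕ) : ℝ :=
  ∑ k ∈ Finset.Icc 1 t, ξ (x.act k) (x.obs k)

lemma pathSum_succ {H A O : Type*} (ξ : A → O → ℝ) (x : Path H A O) (t : ℕ) :
    pathSum ξ x (t + 1) = pathSum ξ x t + ξ (x.act (t + 1)) (x.obs (t + 1)) :=
  Finset.sum_Icc_succ_top (by omega) _

variable {H A O : Type*} [MeasurableSpace O] [Fintype H] [Fintype A] {M : SensingModel H A O}
  {h₀ : H} {β : ℕ → ℝ} {η : ℝ} {Ω : Type*} {mΩ : MeasurableSpace Ω} {P : Measure Ω}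
  {ℱ : Filtration ℕ mΩ} {X : Ω → Path H A O}

lemma IsElimTaSRun.measurable_obs (hX : IsElimTaSRun M h₀ β η P ℱ X) (t : ℕ) :
    Measurable fun ω => (X ω).obs (t + 1) :=
  (hX.obs_adapted t).mono (ℱ.le _) le_rfl

lemma IsElimTaSRun.measurableSet_act (hX : IsElimTaSRun M h₀ β η P ℱ X) (t : ℕ) (a : A) :
    MeasurableSet {ω | (X ω).act (t + 1) = a} :=
  ℱ.le t _ (hX.act_predictable t a)

lemma IsElimTaSRun.setLIntegral_obs (hX : IsElimTaSRun M h₀ β η P ℱ X) (t : ℕ) (a : A)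
    {F : Set Ω} (hF : MeasurableSet[ℱ t] F) {φ : O → ℝ≥0∞} (hφ : Measurable φ) :
    ∫⁻ ω in F ∩ {ω | (X ω).act (t + 1) = a}, φ ((X ω).obs (t + 1)) ∂P =
      P (F ∩ {ω | (X ω).act (t + 1) = a}) * ∫⁻ o, φ o ∂M.obsLaw a h₀ := by
  have hmap : (P.restrict (F ∩ {ω | (X ω).act (t + 1) = a})).map (fun ω => (X ω).obs (t + 1)) =
      P (F ∩ {ω | (X ω).act (t + 1) = a}) • M.obsLaw a h₀ := by
    ext B hB
    rw [Measure.map_apply (hX.measurable_obs t) hB,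
      Measure.restrict_apply (hX.measurable_obs t hB), Set.inter_comm, Measure.smul_apply,
      smul_eq_mul, ← hX.obs_law t a F B hF hB]
    rfl
  rw [← lintegral_map hφ (hX.measurable_obs t), hmap, lintegral_smul_measure, smul_eq_mul]

/-- `obs_law` speaks of events of the past only; the exponential weights used later are functions of
the past. The extension is by induction over functions measurable for `ℱ t`. -/
lemma IsElimTaSRun.setLIntegral_mul_obs (hX : IsElimTaSRun M h₀ β η P ℱ X) (t : ℕ) (a : A)
    {ψ : Ω → ℝ≥0∞} (hψ : Measurable[ℱ t] ψ) {φ : O → ℝ≥0∞} (hφ : Measurable φ) :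
    ∫⁻ ω in {ω | (X ω).act (t + 1) = a}, ψ ω * φ ((X ω).obs (t + 1)) ∂P =
      (∫⁻ ω in {ω | (X ω).act (t + 1) = a}, ψ ω ∂P) * ∫⁻ o, φ o ∂M.obsLaw a h₀ := by
  have hφo : Measurable fun ω => φ ((X ω).obs (t + 1)) := hφ.comp (hX.measurable_obs t)
  refine @Measurable.ennreal_induction Ω (ℱ t) (fun ψ =>
    ∫⁻ ω in {ω | (X ω).act (t + 1) = a}, ψ ω * φ ((X ω).obs (t + 1)) ∂P =
      (∫⁻ ω in {ω | (X ω).act (t + 1) = a}, ψ ω ∂P) * ∫⁻ o, φ o ∂M.obsLaw a h₀) ?_ ?_ ?_ ψ hψ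
  · intro k F hF
    have hF' := ℱ.le t _ hF
    have h1 : (fun ω => F.indicator (fun _ => k) ω * φ ((X ω).obs (t + 1))) =
        F.indicator fun ω => k * φ ((X ω).obs (t + 1)) := by
      ext ω; by_cases h : ω ∈ F <;> simp [h]
    rw [h1, setLIntegral_indicator hF', lintegral_const_mul _ hφo, hX.setLIntegral_obs t a hF hφ,
      setLIntegral_indicator hF', lintegral_const, Measure.restrict_apply_univ, mul_assoc]
  · intro f g _ hf hg hf' hg'
    have hf1 := hf.mono (ℱ.le t) le_rfl
    simp only [Pi.add_apply, add_mul]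
    have hfφ : Measurable fun ω => f ω * φ ((X ω).obs (t + 1)) := hf1.mul hφo
    rw [lintegral_add_left hfφ, hf', hg', lintegral_add_left hf1, add_mul]
  · intro f hf hmono hf'
    have hf1 := fun n => (hf n).mono (ℱ.le t) le_rfl
    simp only [ENNReal.iSup_mul]
    have hfφ : ∀ n, Measurable fun ω => f n ω * φ ((X ω).obs (t + 1)) :=
      fun n => (hf1 n).mul hφo
    rw [lintegral_iSup hfφ
      (fun i j hij ω => mul_le_mul_left (hmono hij ω) _), lintegral_iSup hf1 hmono,
      ENNReal.iSup_mul]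
    exact iSup_congr hf'

/-- One step of sampling: a conditional-expectation bound in integrated form. -/
lemma IsElimTaSRun.lintegral_mul_obs_le (hX : IsElimTaSRun M h₀ β η P ℱ X) (t : ℕ)
    {ψ : Ω → ℝ≥0∞} (hψ : Measurable[ℱ t] ψ) {φ : A → O → ℝ≥0∞} (hφ : ∀ a, Measurable (φ a))
    {C : ℝ≥0∞} (hC : ∀ a, ∫⁻ o, φ a o ∂M.obsLaw a h₀ ≤ C) :
    ∫⁻ ω, ψ ω * φ ((X ω).act (t + 1)) ((X ω).obs (t + 1)) ∂P ≤ C * ∫⁻ ω, ψ ω ∂P := by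
  have huniv : (⋃ a, {ω | (X ω).act (t + 1) = a}) = Set.univ := by
    ext ω; simp
  have hdisj : Pairwise (Function.onFun Disjoint fun a => {ω | (X ω).act (t + 1) = a}) := by
    intro a a' haa'
    refine Set.disjoint_left.2 fun ω h1 h2 => haa' (h1.symm.trans h2)
  have hsplit : ∀ f : Ω → ℝ≥0∞,
      ∫⁻ ω, f ω ∂P = ∑ a, ∫⁻ ω in {ω | (X ω).act (t + 1) = a}, f ω ∂P := by
    intro f
    rw [← setLIntegral_univ, ← huniv, lintegral_iUnion (hX.measurableSet_act t) hdisj,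
      tsum_fintype]
  rw [hsplit, hsplit ψ, Finset.mul_sum]
  refine Finset.sum_le_sum fun a _ => ?_
  rw [setLIntegral_congr_fun (g := fun ω => ψ ω * φ a ((X ω).obs (t + 1)))
    (hX.measurableSet_act t a) (fun ω (hω : _ = a) => by simp only [hω]),
    hX.setLIntegral_mul_obs t a hψ (hφ a), mul_comm]
  gcongr
  exact hC a

lemma IsElimTaSRun.measurable_comp (hX : IsElimTaSRun M h₀ β η P ℱ X) (t : ℕ)
    {ξ : A → O → ℝ} (hξ : ∀ a, Measurable (ξ a)) :
    Measurable[ℱ (t + 1)] fun ω => ξ ((X ω).act (t + 1)) ((X ω).obs (t + 1)) := by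
  intro B hB
  have : (fun ω => ξ ((X ω).act (t + 1)) ((X ω).obs (t + 1))) ⁻¹' B =
      ⋃ a, {ω | (X ω).act (t + 1) = a} ∩ (fun ω => (X ω).obs (t + 1)) ⁻¹' (ξ a ⁻¹' B) := by
    ext ω; simp
  rw [this]
  exact MeasurableSet.iUnion fun a =>
    (ℱ.mono (Nat.le_succ t) _ (hX.act_predictable t a)).inter (hX.obs_adapted t (hξ a hB))

lemma IsElimTaSRun.measurable_pathSum (hX : IsElimTaSRun M h₀ β η P ℱ X)
    {ξ : A → O → ℝ} (hξ : ∀ a, Measurable (ξ a)) (t : ℕ) :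
    Measurable[ℱ t] fun ω => pathSum ξ (X ω) t := by
  induction t with
  | zero => simp only [pathSum, Finset.Icc_eq_empty_of_lt Nat.zero_lt_one, Finset.sum_empty]
            exact measurable_const
  | succ t ih =>
    simp only [pathSum_succ]
    exact (ih.mono (ℱ.mono (Nat.le_succ t)) le_rfl).add (hX.measurable_comp t hξ)

/-- Adaptivity costs nothing because `C` bounds the one-step moment for every action. With `C = 1`
this is the supermartingale property that Ville's inequality asks for. -/
lemma IsElimTaSRun.lintegral_exp_pathSum_succ_le (hX : IsElimTaSRun M h₀ β η P ℱ X)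
    {ξ : A → O → ℝ} (hξ : ∀ a, Measurable (ξ a)) {C : ℝ≥0∞}
    (hC : ∀ a, ∫⁻ o, ENNReal.ofReal (Real.exp (ξ a o)) ∂M.obsLaw a h₀ ≤ C) (t : ℕ)
    {F : Set Ω} (hF : MeasurableSet[ℱ t] F) :
    ∫⁻ ω in F, ENNReal.ofReal (Real.exp (pathSum ξ (X ω) (t + 1))) ∂P ≤
      C * ∫⁻ ω in F, ENNReal.ofReal (Real.exp (pathSum ξ (X ω) t)) ∂P := by
  have hF' := ℱ.le t _ hF
  have hm : Measurable[ℱ t] fun ω => ENNReal.ofReal (Real.exp (pathSum ξ (X ω) t)) :=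
    (Real.measurable_exp.comp (hX.measurable_pathSum hξ t)).ennreal_ofReal
  rw [← lintegral_indicator hF', ← lintegral_indicator hF']
  refine le_trans (le_of_eq (lintegral_congr fun ω => ?_))
    (hX.lintegral_mul_obs_le t (hm.indicator hF)
      (φ := fun a o => ENNReal.ofReal (Real.exp (ξ a o)))
      (fun a => (Real.measurable_exp.comp (hξ a)).ennreal_ofReal) hC)
  by_cases h : ω ∈ F
  · simp only [Set.indicator_of_mem h, pathSum_succ, Real.exp_add]
    rw [ENNReal.ofReal_mul (Real.exp_pos _).le]
  · simp [h]

lemma IsElimTaSRun.lintegral_exp_pathSum_le [IsProbabilityMeasure P]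
    (hX : IsElimTaSRun M h₀ β η P ℱ X)
    {ξ : A → O → ℝ} (hξ : ∀ a, Measurable (ξ a)) {C : ℝ≥0∞}
    (hC : ∀ a, ∫⁻ o, ENNReal.ofReal (Real.exp (ξ a o)) ∂M.obsLaw a h₀ ≤ C) (t : ℕ) :
    ∫⁻ ω, ENNReal.ofReal (Real.exp (pathSum ξ (X ω) t)) ∂P ≤ C ^ t := by
  induction t with
  | zero => simp [pathSum]
  | succ t ih =>
    have := hX.lintegral_exp_pathSum_succ_le hξ hC t MeasurableSet.univ
    simp only [setLIntegral_univ] at this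
    refine this.trans ?_
    rw [pow_succ']
    gcongr

/-- **Ville's inequality** for a nonnegative supermartingale, given in integrated form. -/
lemma measure_exists_le_le_of_setLIntegral_succ_le (ℱ : Filtration ℕ mΩ) {W : ℕ → Ω → ℝ≥0∞}
    (hW : ∀ n, Measurable[ℱ n] (W n))
    (hsuper : ∀ n F, MeasurableSet[ℱ n] F → ∫⁻ ω in F, W (n + 1) ω ∂P ≤ ∫⁻ ω in F, W n ω ∂P)
    (y : ℝ≥0∞) : y * P {ω | ∃ n, y ≤ W n ω} ≤ ∫⁻ ω, W 0 ω ∂P := by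
  set Cr : ℕ → Set Ω := fun n => {ω | ∃ k ≤ n, y ≤ W k ω} with hCr
  have hCr_meas : ∀ n, MeasurableSet[ℱ n] (Cr n) := by
    intro n
    have : Cr n = ⋃ k ∈ Finset.range (n + 1), {ω | y ≤ W k ω} := by
      ext ω; simp [hCr]
    rw [this]
    refine Finset.measurableSet_biUnion _ fun k hk => ?_
    exact ℱ.mono (Nat.lt_succ_iff.1 (Finset.mem_range.1 hk)) _ (hW k measurableSet_Ici)
  have hCr_meas' := fun n => ℱ.le n _ (hCr_meas n)
  have hlow : ∀ (S : Set Ω) (n : ℕ), MeasurableSet S → (∀ ω ∈ S, y ≤ W n ω) →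
      y * P S ≤ ∫⁻ ω in S, W n ω ∂P := by
    intro S n hS h
    rw [← setLIntegral_const]
    exact setLIntegral_mono' hS h
  have hmono : Monotone Cr := fun m n hmn ω ⟨k, hk, h⟩ => ⟨k, hk.trans hmn, h⟩
  -- This is the supermartingale stopped at its first crossing of `y`: paths that cross at time `n +
  -- 1` are charged to `W (n + 1)`, the others go on.
  have key : ∀ n, y * P (Cr n) + ∫⁻ ω in (Cr n)ᶜ, W n ω ∂P ≤ ∫⁻ ω, W 0 ω ∂P := by
    intro n
    induction n with
    | zero =>
      rw [← lintegral_add_compl (W 0) (hCr_meas' 0) (μ := P)]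
      refine add_le_add_left (hlow _ 0 (hCr_meas' 0) ?_) _
      rintro ω ⟨k, hk, h⟩
      rwa [Nat.le_zero.1 hk] at h
    | succ n ih =>
      have hD : MeasurableSet (Cr (n + 1) \ Cr n) := (hCr_meas' _).diff (hCr_meas' _)
      have h1 : P (Cr (n + 1)) = P (Cr n) + P (Cr (n + 1) \ Cr n) := by
        rw [← measure_union Set.disjoint_sdiff_right hD, Set.union_sdiff_cancel (hmono n.le_succ)]
      have h2 : (Cr n)ᶜ = (Cr (n + 1) \ Cr n) ∪ (Cr (n + 1))ᶜ := by
        ext ω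
        have := @hmono n (n + 1) n.le_succ ω
        simp only [Set.mem_compl_iff, Set.mem_union, Set.mem_sdiff]
        tauto
      have h3 : ∫⁻ ω in (Cr n)ᶜ, W (n + 1) ω ∂P = ∫⁻ ω in Cr (n + 1) \ Cr n, W (n + 1) ω ∂P +
          ∫⁻ ω in (Cr (n + 1))ᶜ, W (n + 1) ω ∂P := by
        rw [h2, lintegral_union (hCr_meas' _).compl]
        exact Set.disjoint_left.2 fun ω h h' => h' h.1
      have h4 := hlow _ (n + 1) hD (by
        rintro ω ⟨⟨k, hk, h⟩, hn⟩
        rcases Nat.le_succ_iff.1 hk with hk' | rfl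
        · exact absurd ⟨k, hk', h⟩ hn
        · exact h)
      calc y * P (Cr (n + 1)) + ∫⁻ ω in (Cr (n + 1))ᶜ, W (n + 1) ω ∂P
          = y * P (Cr n) + (y * P (Cr (n + 1) \ Cr n) +
            ∫⁻ ω in (Cr (n + 1))ᶜ, W (n + 1) ω ∂P) := by rw [h1, mul_add, add_assoc]
        _ ≤ y * P (Cr n) + ∫⁻ ω in (Cr n)ᶜ, W (n + 1) ω ∂P := by rw [h3]; gcongr
        _ ≤ y * P (Cr n) + ∫⁻ ω in (Cr n)ᶜ, W n ω ∂P := by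
          exact add_le_add_right (hsuper n _ (hCr_meas n).compl) _
        _ ≤ _ := ih
  have hU : {ω | ∃ n, y ≤ W n ω} = ⋃ n, Cr n := by
    ext ω
    simp only [hCr, Set.mem_ofPred_eq, Set.mem_iUnion]
    exact ⟨fun ⟨n, hn⟩ => ⟨n, n, le_rfl, hn⟩, fun ⟨_, k, _, hk⟩ => ⟨k, hk⟩⟩
  rw [hU, hmono.measure_iUnion, ENNReal.mul_iSup]
  exact iSup_le fun n => le_self_add.trans (key n)

end Sampling

/-! ### One-observation facts: positivity of densities and moment bounds -/

section Model

variable {H A O : Type*} [MeasurableSpace O] {M : SensingModel H A O} {h₀ : H}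

lemma SensingModel.div_nonneg (M : SensingModel H A O) (a : A) (h g : H) : 0 ≤ M.div a h g :=
  ENNReal.toReal_nonneg

lemma SensingModel.div_self (M : SensingModel H A O) (a : A) (h : H) : M.div a h h = 0 := by
  rw [SensingModel.div, klDiv_self, ENNReal.toReal_zero]

lemma SensingModel.FiniteKL.div_eq_zero_iff (hKL : M.FiniteKL) (a : A) (h g : H) :
    M.div a h g = 0 ↔ M.obsLaw a h = M.obsLaw a g := by
  rw [SensingModel.div, ENNReal.toReal_eq_zero_iff, or_iff_left (hKL a h g), klDiv_eq_zero_iff]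

lemma SensingModel.ae_dens_pos_self (M : SensingModel H A O) (a : A) (g : H) :
    ∀ᵐ o ∂M.obsLaw a g, 0 < M.dens a g o := by
  rw [SensingModel.obsLaw, ae_withDensity_iff (M.measurable_dens a g).ennreal_ofReal]
  refine Filter.Eventually.of_forall fun o ho => ?_
  by_contra h
  exact ho (ENNReal.ofReal_of_nonpos (not_lt.1 h))

lemma SensingModel.FiniteKL.ae_dens_pos (hKL : M.FiniteKL) (a : A) (h g : H) :
    ∀ᵐ o ∂M.obsLaw a h, 0 < M.dens a g o :=
  (klDiv_ne_top_iff.1 (hKL a h g)).1.ae_le (M.ae_dens_pos_self a g)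

/-- Integrating `p_g / p_h` against `p_h` loses the mass of `p_g` on `p_h = 0`, hence an inequality.
Finite divergence makes both densities positive almost surely, so the convention `Real.log 0 = 0`
does no harm. -/
lemma SensingModel.FiniteKL.lintegral_exp_log_sub_le (hKL : M.FiniteKL) (a : A) (h g : H) :
    ∫⁻ o, ENNReal.ofReal (Real.exp (Real.log (M.dens a g o) - Real.log (M.dens a h o)))
      ∂M.obsLaw a h ≤ 1 := by
  have h1 : ∫⁻ o, ENNReal.ofReal (Real.exp (Real.log (M.dens a g o) - Real.log (M.dens a h o)))
      ∂M.obsLaw a h = ∫⁻ o, ENNReal.ofReal (M.dens a g o / M.dens a h o) ∂M.obsLaw a h := by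
    refine lintegral_congr_ae ?_
    filter_upwards [hKL.ae_dens_pos a h g, M.ae_dens_pos_self a h] with o ho ho'
    rw [Real.exp_sub, Real.exp_log ho, Real.exp_log ho']
  have hm : Measurable fun o => ENNReal.ofReal (M.dens a g o / M.dens a h o) :=
    ((M.measurable_dens a g).div (M.measurable_dens a h)).ennreal_ofReal
  rw [h1, SensingModel.obsLaw, lintegral_withDensity_eq_lintegral_mul _
    (M.measurable_dens a h).ennreal_ofReal hm, ← M.lintegral_dens a g]
  refine lintegral_mono fun o => ?_
  rw [Pi.mul_apply, ← ENNReal.ofReal_mul (M.dens_nonneg a h o)]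
  refine ENNReal.ofReal_le_ofReal ?_
  rcases (M.dens_nonneg a h o).eq_or_lt with h0 | h0
  · rw [← h0, zero_mul]
    exact M.dens_nonneg a g o
  · rw [mul_div_cancel₀ _ h0.ne']

/-- The centred log-likelihood increment of `h₀` against `g`. -/
noncomputable def SensingModel.centredIncr (M : SensingModel H A O) (h₀ g : H) (a : A) (o : O) :
    ℝ :=
  Real.log (M.dens a h₀ o) - Real.log (M.dens a g o) - M.div a h₀ g

lemma SensingModel.measurable_centredIncr (M : SensingModel H A O) (h₀ g : H) (a : A) :
    Measurable (M.centredIncr h₀ g a) :=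
  ((Real.measurable_log.comp (M.measurable_dens a h₀)).sub
    (Real.measurable_log.comp (M.measurable_dens a g))).sub_const _

lemma SensingModel.lintegral_exp_centredIncr_le (hKL : M.FiniteKL) {v : ℝ≥0}
    (hsub : M.SubGaussianAt h₀ v) (l : ℝ) (a : A) (g : H) :
    ∫⁻ o, ENNReal.ofReal (Real.exp (l * M.centredIncr h₀ g a o)) ∂M.obsLaw a h₀ ≤
      ENNReal.ofReal (Real.exp (v * l ^ 2 / 2)) := by
  by_cases hg : g = h₀
  · subst hg
    simp only [SensingModel.centredIncr, sub_self, M.div_self, mul_zero, Real.exp_zero,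
      lintegral_const, measure_univ, mul_one]
    exact ENNReal.ofReal_le_ofReal (Real.one_le_exp (by positivity))
  have hs := hsub a g hg
  have h1 : ∫⁻ o, ENNReal.ofReal (Real.exp (l * M.centredIncr h₀ g a o)) ∂M.obsLaw a h₀ =
      ∫⁻ o, ENNReal.ofReal (Real.exp (l * (Real.log (M.dens a h₀ o / M.dens a g o) -
        M.div a h₀ g))) ∂M.obsLaw a h₀ := by
    refine lintegral_congr_ae ?_
    filter_upwards [hKL.ae_dens_pos a h₀ g, M.ae_dens_pos_self a h₀] with o ho ho'
    rw [SensingModel.centredIncr, Real.log_div ho'.ne' ho.ne']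
  rw [h1, ← ofReal_integral_eq_lintegral_ofReal (hs.integrable_exp_mul l)
    (Filter.Eventually.of_forall fun o => (Real.exp_pos _).le)]
  exact ENNReal.ofReal_le_ofReal (hs.mgf_le l)

end Model

/-! ### Concentration of log-likelihood ratios and the random time `R` -/

section Concentration

variable {H A O : Type*} [MeasurableSpace O] [Fintype H] [Fintype A] {M : SensingModel H A O}
  {h₀ : H} {β : ℕ → ℝ} {η : ℝ} {Ω : Type*} {mΩ : MeasurableSpace Ω} {P : Measure Ω}
  {ℱ : Filtration ℕ mΩ} {X : Ω → Path H A O}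

lemma llRatio_eq_pathSum {H A O : Type*} [MeasurableSpace O] (M : SensingModel H A O)
    (x : Path H A O) (t : ℕ) (h g : H) :
    llRatio M x t h g =
      pathSum (fun a o => Real.log (M.dens a h o) - Real.log (M.dens a g o)) x t := by
  simp only [llRatio, logLik, pathSum, Finset.sum_sub_distrib]

/-- The likelihood ratio of `g` against the truth is a nonnegative supermartingale started at `1`,
so Ville's inequality covers all times at once. -/
lemma IsElimTaSRun.measure_exists_le_llRatio [IsProbabilityMeasure P]
    (hX : IsElimTaSRun M h₀ β η P ℱ X)
    (hKL : M.FiniteKL) (g : H) (y : ℝ) :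
    P {ω | ∃ n, y ≤ llRatio M (X ω) n g h₀} ≤ ENNReal.ofReal (Real.exp (-y)) := by
  set ξ : A → O → ℝ := fun a o => Real.log (M.dens a g o) - Real.log (M.dens a h₀ o) with hξ
  have hξm : ∀ a, Measurable (ξ a) := fun a =>
    (Real.measurable_log.comp (M.measurable_dens a g)).sub
      (Real.measurable_log.comp (M.measurable_dens a h₀))
  have hV := measure_exists_le_le_of_setLIntegral_succ_le (P := P) ℱ
    (W := fun n ω => ENNReal.ofReal (Real.exp (pathSum ξ (X ω) n)))
    (fun n => (Real.measurable_exp.comp (hX.measurable_pathSum hξm n)).ennreal_ofReal)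
    (fun n F hF => (hX.lintegral_exp_pathSum_succ_le hξm
      (fun a => hKL.lintegral_exp_log_sub_le a h₀ g) n hF).trans (one_mul _).le)
    (ENNReal.ofReal (Real.exp y))
  have h0 : ∫⁻ ω, ENNReal.ofReal (Real.exp (pathSum ξ (X ω) 0)) ∂P = 1 := by
    simp [pathSum]
  have hset : {ω | ∃ n, y ≤ llRatio M (X ω) n g h₀} = {ω | ∃ n,
      ENNReal.ofReal (Real.exp y) ≤ ENNReal.ofReal (Real.exp (pathSum ξ (X ω) n))} := by
    ext ω
    simp only [Set.mem_ofPred_eq, llRatio_eq_pathSum,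
      ENNReal.ofReal_le_ofReal_iff (Real.exp_pos _).le, Real.exp_le_exp]
    rfl
  rw [h0] at hV
  rw [hset, Real.exp_neg, ENNReal.ofReal_inv_of_pos (Real.exp_pos y), ← one_div]
  rw [mul_comm] at hV
  exact (ENNReal.le_div_iff_mul_le (Or.inl (by simp [Real.exp_pos]))
    (Or.inl ENNReal.ofReal_ne_top)).2 hV

lemma IsElimTaSRun.measure_le_mul_pathSum_le [IsProbabilityMeasure P]
    (hX : IsElimTaSRun M h₀ β η P ℱ X)
    (hKL : M.FiniteKL) {v : ℝ≥0} (hsub : M.SubGaussianAt h₀ v) (g : H) (t : ℕ) (l y : ℝ) :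
    P {ω | y ≤ l * pathSum (M.centredIncr h₀ g) (X ω) t} ≤
      ENNReal.ofReal (Real.exp (t * (v * l ^ 2 / 2) - y)) := by
  have h1 := hX.lintegral_exp_pathSum_le (ξ := fun a o => l * M.centredIncr h₀ g a o)
    (fun a => (M.measurable_centredIncr h₀ g a).const_mul l)
    (fun a => M.lintegral_exp_centredIncr_le hKL hsub l a g) t
  have h2 : ∀ ω, pathSum (fun a o => l * M.centredIncr h₀ g a o) (X ω) t =
      l * pathSum (M.centredIncr h₀ g) (X ω) t := fun ω => by
    simp only [pathSum, Finset.mul_sum]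
  simp only [h2] at h1
  have hm : Measurable fun ω =>
      ENNReal.ofReal (Real.exp (l * pathSum (M.centredIncr h₀ g) (X ω) t)) :=
    (Real.measurable_exp.comp (((hX.measurable_pathSum (M.measurable_centredIncr h₀ g) t).mono
      (ℱ.le t) le_rfl).const_mul l)).ennreal_ofReal
  have h3 := mul_meas_ge_le_lintegral (μ := P) hm (ENNReal.ofReal (Real.exp y))
  simp only [ENNReal.ofReal_le_ofReal_iff (Real.exp_pos _).le, Real.exp_le_exp] at h3
  rw [Real.exp_sub, ENNReal.ofReal_div_of_pos (Real.exp_pos _), Real.exp_nat_mul,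
    ENNReal.ofReal_pow (Real.exp_pos _).le]
  refine (ENNReal.le_div_iff_mul_le (Or.inl (by simp [Real.exp_pos]))
    (Or.inl ENNReal.ofReal_ne_top)).2 ?_
  rw [mul_comm]
  exact h3.trans h1

/-- The growth function `√(t log (e + t))`. -/
noncomputable def growth (t : ℝ) : ℝ := Real.sqrt (t * Real.log (Real.exp 1 + t))

/-- The sample paths on which some centred log-likelihood ratio is large after round `t`. -/
def deviationSet {H A O Ω : Type*} [MeasurableSpace O] (M : SensingModel H A O) (h₀ : H)
    (v : ℝ≥0) (X : Ω → Path H A O) (t : ℕ) : Set Ω :=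
  {ω | ∃ g, Real.sqrt (6 * (v + 1)) * growth t < |pathSum (M.centredIncr h₀ g) (X ω) t|}

lemma IsElimTaSRun.measurableSet_deviationSet (hX : IsElimTaSRun M h₀ β η P ℱ X) (v : ℝ≥0)
    (t : ℕ) : MeasurableSet (deviationSet M h₀ v X t) := by
  have : deviationSet M h₀ v X t = ⋃ g, {ω | Real.sqrt (6 * (v + 1)) * growth t <
      |pathSum (M.centredIncr h₀ g) (X ω) t|} := by
    ext ω; simp [deviationSet]
  rw [this]
  refine MeasurableSet.iUnion fun g => ?_
  have hm := (hX.measurable_pathSum (M.measurable_centredIncr h₀ g) t).mono (ℱ.le t) le_rfl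
  exact measurableSet_lt measurable_const (continuous_abs.measurable.comp hm)

lemma IsElimTaSRun.measure_deviationSet_le [IsProbabilityMeasure P]
    (hX : IsElimTaSRun M h₀ β η P ℱ X)
    (hKL : M.FiniteKL) {v : ℝ≥0} (hsub : M.SubGaussianAt h₀ v) {t : ℕ} (ht : 1 ≤ t) :
    P (deviationSet M h₀ v X t) ≤
      ENNReal.ofReal (2 * Fintype.card H / ((t : ℝ) + 1) ^ 3) := by
  have ht' : (1 : ℝ) ≤ t := by exact_mod_cast ht
  set ℓ := Real.log (Real.exp 1 + t) with hℓ
  have he : 1 ≤ Real.exp 1 := Real.one_le_exp (by norm_num)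
  have hℓpos : 0 < ℓ := Real.log_pos (by linarith)
  -- `v + 1` instead of `v` keeps the division legitimate when `v = 0`.
  set V : ℝ := v + 1 with hV
  have hVpos : 0 < V := by positivity
  -- With this Chernoff parameter the exponent is at most `3ℓ - 6ℓ`, which gives a tail of order
  -- `t⁻³`: summable even after weighting by `t`.
  set l : ℝ := Real.sqrt (6 * ℓ / (V * t)) with hl
  have hl2 : l ^ 2 = 6 * ℓ / (V * t) := Real.sq_sqrt (by positivity)
  have hlpos : 0 < l := Real.sqrt_pos.2 (by positivity)
  set y : ℝ := l * (Real.sqrt (6 * V) * growth t) with hy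
  have hy' : y = 6 * ℓ := by
    rw [hy, growth, ← hℓ, hl, ← Real.sqrt_mul (by positivity), ← Real.sqrt_mul (by positivity)]
    rw [show 6 * ℓ / (V * t) * (6 * V * (t * ℓ)) = (6 * ℓ) ^ 2 by field_simp]
    exact Real.sqrt_sq (by positivity)
  have hbound : ∀ l' : ℝ, l' ^ 2 = l ^ 2 →
      ENNReal.ofReal (Real.exp (t * (v * l' ^ 2 / 2) - y)) ≤
        ENNReal.ofReal (1 / ((t : ℝ) + 1) ^ 3) := by
    intro l' hl'
    refine ENNReal.ofReal_le_ofReal ?_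
    have h1 : (t : ℝ) * (v * l' ^ 2 / 2) - y ≤ -(3 * ℓ) := by
      rw [hl', hl2, hy']
      have : (t : ℝ) * (v * (6 * ℓ / (V * t)) / 2) = 3 * ℓ * (v / V) := by field_simp; ring
      rw [this]
      have : (v : ℝ) / V ≤ 1 := (div_le_one hVpos).2 (by linarith)
      nlinarith
    have h2 : Real.exp (-(3 * ℓ)) = 1 / (Real.exp 1 + t) ^ 3 := by
      rw [Real.exp_neg, mul_comm, show ℓ * 3 = ((3 : ℕ) : ℝ) * ℓ by push_cast; ring,
        Real.exp_nat_mul, hℓ, Real.exp_log (by linarith), one_div]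
    calc Real.exp _ ≤ Real.exp (-(3 * ℓ)) := Real.exp_le_exp.2 h1
      _ = 1 / (Real.exp 1 + t) ^ 3 := h2
      _ ≤ _ := by
        apply one_div_le_one_div_of_le (by positivity)
        gcongr ?_ ^ 3
        linarith
  have hsubset : deviationSet M h₀ v X t ⊆ ⋃ g ∈ (Finset.univ : Finset H),
      ({ω | y ≤ l * pathSum (M.centredIncr h₀ g) (X ω) t} ∪
        {ω | y ≤ -l * pathSum (M.centredIncr h₀ g) (X ω) t}) := by
    rintro ω ⟨g, hg⟩
    simp only [Finset.mem_univ, Set.iUnion_true, Set.mem_iUnion]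
    refine ⟨g, ?_⟩
    rcases lt_abs.1 hg with h | h
    · exact Or.inl (mul_le_mul_of_nonneg_left h.le hlpos.le)
    · refine Or.inr ?_
      have := mul_le_mul_of_nonneg_left h.le hlpos.le
      simp only [Set.mem_ofPred_eq]
      linarith
  calc P (deviationSet M h₀ v X t) ≤ ∑ g : H, P ({ω | y ≤ l * pathSum (M.centredIncr h₀ g) (X ω) t} ∪
        {ω | y ≤ -l * pathSum (M.centredIncr h₀ g) (X ω) t}) :=
        (measure_mono hsubset).trans (measure_biUnion_finset_le _ _)
    _ ≤ ∑ g : H, (ENNReal.ofReal (1 / ((t : ℝ) + 1) ^ 3) +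
          ENNReal.ofReal (1 / ((t : ℝ) + 1) ^ 3)) := by
        refine Finset.sum_le_sum fun g _ => (measure_union_le _ _).trans (add_le_add ?_ ?_)
        · exact (hX.measure_le_mul_pathSum_le hKL hsub g t l y).trans (hbound l rfl)
        · exact (hX.measure_le_mul_pathSum_le hKL hsub g t (-l) y).trans (hbound _ (neg_sq l))
    _ = _ := by
        rw [← ENNReal.ofReal_add (by positivity) (by positivity), Finset.sum_const,
          Finset.card_univ, nsmul_eq_mul, ← ENNReal.ofReal_natCast,
          ← ENNReal.ofReal_mul (by positivity)]
        congr 1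
        ring

/-- A random time after which all centred log-likelihood ratios are under control. -/
noncomputable def concentrationTime {H A O Ω : Type*} [MeasurableSpace O]
    (M : SensingModel H A O) (h₀ : H) (v : ℝ≥0) (X : Ω → Path H A O) (ω : Ω) : ℝ≥0∞ :=
  1 + ∑' n : ℕ, (deviationSet M h₀ v X (n + 1)).indicator (fun _ => (n : ℝ≥0∞) + 2) ω

lemma IsElimTaSRun.measurable_concentrationTime (hX : IsElimTaSRun M h₀ β η P ℱ X) (v : ℝ≥0) :
    Measurable (concentrationTime M h₀ v X) :=
  have hm : Measurable fun ω => ∑' n : ℕ,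
      (deviationSet M h₀ v X (n + 1)).indicator (fun _ => (n : ℝ≥0∞) + 2) ω :=
    Measurable.tsum fun n => measurable_const.indicator (hX.measurableSet_deviationSet v (n + 1))
  measurable_const.add hm

lemma not_mem_deviationSet_of_concentrationTime_le {H A O Ω : Type*} [MeasurableSpace O]
    {M : SensingModel H A O} {h₀ : H} {X : Ω → Path H A O} {v : ℝ≥0} {ω : Ω} {t : ℕ} (ht : 1 ≤ t)
    (h : concentrationTime M h₀ v X ω ≤ t) : ω ∉ deviationSet M h₀ v X t := by
  intro hmem
  obtain ⟨n, rfl⟩ : ∃ n, t = n + 1 := ⟨t - 1, by omega⟩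
  have h1 : (n : ℝ≥0∞) + 2 ≤
      ∑' n : ℕ, (deviationSet M h₀ v X (n + 1)).indicator (fun _ => (n : ℝ≥0∞) + 2) ω := by
    refine le_trans (le_of_eq ?_) (ENNReal.le_tsum n)
    rw [Set.indicator_of_mem hmem]
  -- A deviation in round `n + 1` contributes `n + 2`, which already exceeds the round.
  have h2 : ((n + 2 : ℕ) : ℝ≥0∞) ≤ ((n + 1 : ℕ) : ℝ≥0∞) :=
    (by push_cast; exact h1 : ((n + 2 : ℕ) : ℝ≥0∞) ≤ _).trans (le_add_self.trans h)
  have := Nat.cast_le.1 h2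
  omega

/-- A bound on the mean of the concentration time that depends on the number of hypotheses only. -/
noncomputable def concentrationBound (H : Type*) [Fintype H] : ℝ≥0∞ :=
  1 + ∑' n : ℕ, ENNReal.ofReal (2 * Fintype.card H * (1 / ((n : ℝ) + 1) ^ 2))

lemma concentrationBound_ne_top (H : Type*) [Fintype H] : concentrationBound H ≠ ⊤ := by
  refine ENNReal.add_ne_top.2 ⟨ENNReal.one_ne_top, ?_⟩
  have hs : Summable fun n : ℕ => 2 * (Fintype.card H : ℝ) * (1 / ((n : ℝ) + 1) ^ 2) := by
    refine Summable.mul_left _ ?_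
    have := (summable_nat_add_iff (f := fun n : ℕ => 1 / (n : ℝ) ^ 2) 1).2
      (Real.summable_one_div_nat_pow.2 (by norm_num))
    simpa using this
  exact hs.tsum_ofReal_ne_top

lemma IsElimTaSRun.lintegral_concentrationTime_le [IsProbabilityMeasure P]
    (hX : IsElimTaSRun M h₀ β η P ℱ X)
    (hKL : M.FiniteKL) {v : ℝ≥0} (hsub : M.SubGaussianAt h₀ v) :
    ∫⁻ ω, concentrationTime M h₀ v X ω ∂P ≤ concentrationBound H := by
  simp only [concentrationTime, concentrationBound]
  rw [lintegral_add_left measurable_const, lintegral_one, measure_univ,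
    lintegral_tsum fun n => (measurable_const.indicator
      (hX.measurableSet_deviationSet v (n + 1))).aemeasurable]
  gcongr with n
  rw [lintegral_indicator_const (hX.measurableSet_deviationSet v (n + 1))]
  calc ((n : ℝ≥0∞) + 2) * P (deviationSet M h₀ v X (n + 1))
      ≤ ENNReal.ofReal ((n : ℝ) + 2) *
        ENNReal.ofReal (2 * Fintype.card H / (((n + 1 : ℕ) : ℝ) + 1) ^ 3) := by
        gcongr
        · rw [ENNReal.ofReal_add (by positivity) (by positivity)]; simp
        · exact hX.measure_deviationSet_le hKL hsub (by omega)
    _ ≤ _ := by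
        rw [← ENNReal.ofReal_mul (by positivity)]
        refine ENNReal.ofReal_le_ofReal ?_
        push_cast
        have h1 : ((n : ℝ) + 2) * (2 * Fintype.card H / ((n : ℝ) + 1 + 1) ^ 3) =
            2 * Fintype.card H * (1 / ((n : ℝ) + 2) ^ 2) := by
          rw [show (n : ℝ) + 1 + 1 = n + 2 by ring]; field_simp
        rw [h1]
        gcongr
        linarith

end Concentration

/-! ### The noise scale `√(t log (e + t))` -/

section Growth

lemma one_le_log_exp_one_add {t : ℝ} (ht : 0 ≤ t) : 1 ≤ Real.log (Real.exp 1 + t) := by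
  rw [Real.le_log_iff_exp_le (by positivity)]
  linarith

lemma growth_nonneg (t : ℝ) : 0 ≤ growth t := Real.sqrt_nonneg _

lemma growth_mono {s t : ℝ} (hs : 0 ≤ s) (hst : s ≤ t) : growth s ≤ growth t := by
  have h1 := one_le_log_exp_one_add hs
  have h2 : Real.log (Real.exp 1 + s) ≤ Real.log (Real.exp 1 + t) :=
    Real.log_le_log (by positivity) (by linarith)
  exact Real.sqrt_le_sqrt (mul_le_mul hst h2 (by linarith) (by linarith))

lemma sqrt_le_growth {t : ℝ} (ht : 0 ≤ t) : Real.sqrt t ≤ growth t :=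
  Real.sqrt_le_sqrt (le_mul_of_one_le_right ht (one_le_log_exp_one_add ht))

lemma one_le_growth {t : ℝ} (ht : 1 ≤ t) : 1 ≤ growth t :=
  (Real.one_le_sqrt.2 ht).trans (sqrt_le_growth (by linarith))

end Growth

/-! ### Active-opponent sets -/

section ActiveSet

variable {H A O : Type*} [MeasurableSpace O] {M : SensingModel H A O} {β : ℕ → ℝ}
  {x : Path H A O}

lemma mem_activeSet [Fintype H] {t : ℕ} {i g : H} :
    g ∈ activeSet M β x t i ↔
      g ≠ i ∧ ∀ s, 1 ≤ s → s ≤ t → x.champ s = i → llRatio M x s i g < β s := by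
  classical
  simp [activeSet, opponents]

lemma mem_opponents [Fintype H] {i g : H} : g ∈ opponents i ↔ g ≠ i := by
  classical
  simp [opponents]

lemma activeSet_anti [Fintype H] {s t : ℕ} (hst : s ≤ t) (i : H) :
    activeSet M β x t i ⊆ activeSet M β x s i := fun _ hg => by
  rw [mem_activeSet] at hg ⊢
  exact ⟨hg.1, fun k hk hks => hg.2 k hk (hks.trans hst)⟩

lemma activeSet_champ_nonempty [Fintype H] {t : ℕ} (ht : 1 ≤ t)
    (hτ : (t : ℕ∞) < stopTime M β x) : (activeSet M β x t (x.champ t)).Nonempty := by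
  rw [Finset.nonempty_iff_ne_empty]
  exact fun h => absurd hτ (not_lt.2 (iInf₂_le t ⟨ht, h⟩))

end ActiveSet

/-! ### Counting actions and champions -/

section Counts

variable {H A O : Type*} {x : Path H A O}

lemma actCount_zero (a : A) : actCount x 0 a = 0 := by
  simp [actCount]

open Classical in
lemma actCount_succ (t : ℕ) (a : A) :
    actCount x (t + 1) a = actCount x t a + if x.act (t + 1) = a then 1 else 0 := by
  simp only [actCount, ← Finset.insert_Icc_right_eq_Icc_add_one (show 1 ≤ t + 1 by omega),
    Finset.filter_insert]
  split_ifs with h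
  · rw [Finset.card_insert_of_notMem (by simp)]
  · rfl

lemma sum_act_eq [Fintype A] (f : A → ℝ) (t : ℕ) :
    ∑ k ∈ Finset.Icc 1 t, f (x.act k) = ∑ a, (actCount x t a : ℝ) * f a := by
  classical
  induction t with
  | zero => simp [actCount_zero]
  | succ t ih =>
    rw [Finset.sum_Icc_succ_top (by omega), ih]
    simp [actCount_succ, add_mul, Finset.sum_add_distrib]

lemma cumTarget_zero (a : A) : cumTarget x 0 a = 0 := by
  simp [cumTarget]

lemma cumTarget_succ (t : ℕ) (a : A) :
    cumTarget x (t + 1) a = cumTarget x t a + x.target (t + 1) a :=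
  Finset.sum_Icc_succ_top (by omega) _

/-- The number of rounds `1, …, t` in which `i` is the champion. -/
noncomputable def champCount (x : Path H A O) (t : ℕ) (i : H) : ℕ :=
  open Classical in ((Finset.Icc 1 t).filter fun s => x.champ s = i).card

lemma champCount_le (t : ℕ) (i : H) : champCount x t i ≤ t := by
  classical
  exact (Finset.card_filter_le _ _).trans (by simp)

lemma sum_champCount [Fintype H] (t : ℕ) : ∑ i, champCount x t i = t := by
  classical
  have h := Finset.card_eq_sum_card_fiberwise (s := Finset.Icc 1 t) (f := x.champ)
    (t := Finset.univ) (fun _ _ => Finset.mem_coe.2 (Finset.mem_univ _))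
  simp only [Nat.card_Icc, Nat.add_sub_cancel] at h
  exact h.symm

open Classical in
lemma champCount_succ (t : ℕ) (i : H) :
    champCount x (t + 1) i = champCount x t i + if x.champ (t + 1) = i then 1 else 0 := by
  simp only [champCount, ← Finset.insert_Icc_right_eq_Icc_add_one (show 1 ≤ t + 1 by omega),
    Finset.filter_insert]
  split_ifs with h
  · rw [Finset.card_insert_of_notMem (by simp)]
  · rfl

/-- The champion count is attained at the last round in which `i` is the champion. -/
lemma champCount_eq_zero_or (t : ℕ) (i : H) :
    champCount x t i = 0 ∨
      ∃ s, 1 ≤ s ∧ s ≤ t ∧ x.champ s = i ∧ champCount x t i = champCount x s i := by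
  induction t with
  | zero => exact Or.inl (by simp [champCount])
  | succ t ih =>
    by_cases h : x.champ (t + 1) = i
    · exact Or.inr ⟨t + 1, by omega, le_rfl, h, rfl⟩
    · rw [champCount_succ, if_neg h, add_zero]
      exact ih.imp id fun ⟨s, h1, h2, h3⟩ => ⟨s, h1, by omega, h3⟩

end Counts

/-! ### C-Tracking: actions follow the oracle allocations up to `O(√t)` -/

section Tracking

variable {H A O : Type*} [Fintype H] [Fintype A] [MeasurableSpace O] {M : SensingModel H A O}
  {h₀ : H} {β : ℕ → ℝ} {η : ℝ} {x : Path H A O}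

lemma FollowsElimTaS.target_mem_stdSimplex (hx : FollowsElimTaS M β η x) {t : ℕ}
    (ht : (t : ℕ∞) < stopTime M β x) : x.target t ∈ stdSimplex ℝ A :=
  (hx.target_mem t ht).1.1

lemma FollowsElimTaS.sum_cumTarget_sub (hx : FollowsElimTaS M β η x) {t : ℕ}
    (ht : (t : ℕ∞) < stopTime M β x) : ∑ a, (cumTarget x t a - actCount x t a) = 0 := by
  have h1 := sum_act_eq (x := x) (fun _ => (1 : ℝ)) t
  simp only [Finset.sum_const, Nat.card_Icc, Nat.add_sub_cancel, nsmul_eq_mul, mul_one] at h1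
  have h2 : ∑ a, cumTarget x t a = t := by
    simp only [cumTarget]
    rw [Finset.sum_comm, Finset.sum_congr rfl fun s hs =>
      (hx.target_mem_stdSimplex (lt_of_le_of_lt
        (by exact_mod_cast (Finset.mem_Icc.1 hs).2) ht)).2]
    simp
  rw [Finset.sum_sub_distrib, h2, ← h1, sub_self]

lemma FollowsElimTaS.actCount_le (hx : FollowsElimTaS M β η x) {t : ℕ}
    (ht : (t : ℕ∞) < stopTime M β x) (a : A) : (actCount x t a : ℝ) ≤ cumTarget x t a + 1 := by
  classical
  induction t with
  | zero => simp [actCount_zero, cumTarget_zero]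
  | succ t ih =>
    have ht' : (t : ℕ∞) < stopTime M β x :=
      lt_of_le_of_lt (by exact_mod_cast Nat.le_succ t) ht
    have hpos := (hx.target_mem_stdSimplex ht).1 a
    rw [actCount_succ, cumTarget_succ]
    split_ifs with h
    · have hmax := hx.track t ht'
      rw [h] at hmax
      -- The chosen action has the largest deficit, and the deficits sum to zero.
      have : 0 ≤ cumTarget x t a - actCount x t a := by
        by_contra hneg
        have := Finset.sum_lt_sum_of_nonempty (s := Finset.univ) ⟨a, Finset.mem_univ a⟩
          (fun b _ => (hmax b).trans_lt (not_le.1 hneg))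
        rw [hx.sum_cumTarget_sub ht', Finset.sum_const_zero] at this
        exact lt_irrefl _ this
      push_cast
      linarith
    · have := ih ht'
      push_cast
      linarith

/-- No action is over-represented by more than one, and the deficits sum to zero, so no single
deficit can be large. -/
lemma FollowsElimTaS.cumTarget_le (hx : FollowsElimTaS M β η x) {t : ℕ}
    (ht : (t : ℕ∞) < stopTime M β x) (a : A) :
    cumTarget x t a ≤ actCount x t a + Fintype.card A := by
  have h1 : ∑ b, (cumTarget x t b - actCount x t b + 1) = Fintype.card A := by
    rw [Finset.sum_add_distrib, hx.sum_cumTarget_sub ht]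
    simp
  have h2 := Finset.single_le_sum (f := fun b => cumTarget x t b - actCount x t b + 1)
    (fun b _ => by have := hx.actCount_le ht b; linarith) (Finset.mem_univ a)
  simp only [h1] at h2
  linarith

lemma abs_sub_le_of_mem_flooredProjections {ε : ℝ} (hε : 0 ≤ ε) (hε' : (Fintype.card A : ℝ) * ε ≤ 1)
    {u w : A → ℝ} (hu : u ∈ stdSimplex ℝ A) (hw : w ∈ flooredProjections ε u) (a : A) :
    |w a - u a| ≤ (Fintype.card A : ℝ) * ε := by
  set n : ℝ := (Fintype.card A : ℝ) with hn
  have hn1 : 1 ≤ n := by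
    have : 1 ≤ Fintype.card A := Fintype.card_pos_iff.2 ⟨a⟩
    rw [hn]
    exact_mod_cast this
  -- Mixing `u` with the uniform allocation gives a competitor at distance at most `n * ε`; the
  -- projection is no farther away.
  have hmem : (fun b => (1 - n * ε) * u b + ε) ∈ flooredSimplex A ε := by
    refine ⟨⟨fun b => ?_, ?_⟩, fun b => ?_⟩
    · have := mul_nonneg (sub_nonneg.2 hε') (hu.1 b)
      simp only
      linarith
    · rw [Finset.sum_add_distrib, ← Finset.mul_sum, hu.2, Finset.sum_const, Finset.card_univ,
        nsmul_eq_mul]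
      ring
    · have := mul_nonneg (sub_nonneg.2 hε') (hu.1 b)
      simp only
      linarith
  refine (norm_le_pi_norm (w - u) a).trans ((hw.2 _ hmem).trans ?_)
  rw [pi_norm_le_iff_of_nonneg (by positivity)]
  intro b
  have hb0 := hu.1 b
  have hb1 : u b ≤ 1 := by
    rw [← hu.2]
    exact Finset.single_le_sum (fun c _ => hu.1 c) (Finset.mem_univ b)
  have h1 : n * ε * u b ≤ n * ε := mul_le_of_le_one_right (by positivity) hb1
  have h2 : 0 ≤ n * ε * u b := by positivity
  have h3 : ε ≤ n * ε := le_mul_of_one_le_left hε hn1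
  rw [Pi.sub_apply, Real.norm_eq_abs, abs_le]
  constructor <;> nlinarith

lemma explorationFloor_nonneg (hη : 0 ≤ η) (t : ℕ) : 0 ≤ explorationFloor A η t := by
  unfold explorationFloor
  positivity

lemma card_mul_explorationFloor_le (hη : η ≤ 1) (t : ℕ) :
    (Fintype.card A : ℝ) * explorationFloor A η t ≤ 1 := by
  unfold explorationFloor
  set n : ℝ := (Fintype.card A : ℝ)
  have hn : 0 ≤ n := Nat.cast_nonneg _
  have h1 : n ≤ Real.sqrt (n ^ 2 + t) := Real.le_sqrt_of_sq_le (by simp)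
  rw [← mul_div_assoc]
  refine div_le_one_of_le₀ ?_ (by positivity)
  nlinarith

/-- Each floor is at most `1 / (2√s) ≤ √s - √(s - 1)`, and the differences telescope. -/
lemma sum_explorationFloor_le (hη : η ≤ 1) (t : ℕ) :
    ∑ s ∈ Finset.Icc 1 t, explorationFloor A η s ≤ Real.sqrt t := by
  induction t with
  | zero => simp
  | succ t ih =>
    rw [Finset.sum_Icc_succ_top (by omega)]
    have h0 : 0 < Real.sqrt ((t + 1 : ℕ) : ℝ) := Real.sqrt_pos.2 (by positivity)
    have h1 : explorationFloor A η (t + 1) ≤ 1 / (2 * Real.sqrt ((t + 1 : ℕ) : ℝ)) := by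
      unfold explorationFloor
      apply div_le_div₀ zero_le_one hη (by positivity)
      gcongr
      simp
    have h2 : 1 / (2 * Real.sqrt ((t + 1 : ℕ) : ℝ)) ≤
        Real.sqrt ((t + 1 : ℕ) : ℝ) - Real.sqrt t := by
      rw [div_le_iff₀ (by positivity)]
      have h3 : Real.sqrt ((t + 1 : ℕ) : ℝ) ^ 2 = t + 1 := by
        rw [Real.sq_sqrt (by positivity)]; push_cast; ring
      have h4 : Real.sqrt (t : ℝ) ^ 2 = t := Real.sq_sqrt (by positivity)
      nlinarith [sq_nonneg (Real.sqrt ((t + 1 : ℕ) : ℝ) - Real.sqrt t)]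
    linarith

/-- Under C-Tracking the actions accumulate what the oracle allocations prescribe, up to an error
of order `√t`. -/
lemma FollowsElimTaS.sum_oracle_le (hx : FollowsElimTaS M β η x) (hη : η ∈ Set.Icc (0 : ℝ) 1)
    {t : ℕ} (ht : (t : ℕ∞) < stopTime M β x) {f : A → ℝ} (hf : ∀ a, 0 ≤ f a) :
    ∑ s ∈ Finset.Icc 1 t, ∑ a, x.oracle s a * f a ≤
      ∑ k ∈ Finset.Icc 1 t, f (x.act k) +
        (∑ a, f a) * (Fintype.card A * (1 + Real.sqrt t)) := by
  have key : ∀ a, ∑ s ∈ Finset.Icc 1 t, x.oracle s a ≤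
      actCount x t a + Fintype.card A * (1 + Real.sqrt t) := by
    intro a
    have h1 : ∀ s ∈ Finset.Icc 1 t, x.oracle s a ≤
        x.target s a + Fintype.card A * explorationFloor A η s := by
      intro s hs
      have hs' : (s : ℕ∞) < stopTime M β x :=
        lt_of_le_of_lt (by exact_mod_cast (Finset.mem_Icc.1 hs).2) ht
      have := abs_sub_le_of_mem_flooredProjections (explorationFloor_nonneg hη.1 s)
        (card_mul_explorationFloor_le hη.2 s) (hx.oracle_mem s hs').1 (hx.target_mem s hs') a
      linarith [(abs_le.1 this).1]
    have h2 := Finset.sum_le_sum h1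
    rw [Finset.sum_add_distrib, ← Finset.mul_sum] at h2
    have h3 := hx.cumTarget_le ht a
    have h4 := mul_le_mul_of_nonneg_left (sum_explorationFloor_le (A := A) hη.2 t)
      (Nat.cast_nonneg (α := ℝ) (Fintype.card A))
    simp only [cumTarget] at h3
    linarith
  rw [sum_act_eq, Finset.sum_comm, Finset.sum_mul, ← Finset.sum_add_distrib]
  refine Finset.sum_le_sum fun a _ => ?_
  rw [← Finset.sum_mul, mul_comm (f a), ← add_mul]
  exact mul_le_mul_of_nonneg_right (key a) (hf a)

end Tracking

/-! ### Divergence comparison and oracle rates -/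

section Rates

variable {H A O : Type*} [MeasurableSpace O] {M : SensingModel H A O}

/-- `dmin` is a positive lower bound on the nonzero divergences and `dmax` an upper bound on all
divergences. -/
structure SensingModel.DivBounds (M : SensingModel H A O) (dmin dmax : ℝ) : Prop where
  pos : 0 < dmin
  nonneg : 0 ≤ dmax
  eq_zero_or_le : ∀ a h g, M.div a h g = 0 ∨ dmin ≤ M.div a h g
  le : ∀ a h g, M.div a h g ≤ dmax

/-- A substitute for the triangle inequality: an action that separates `i` from `g` separates `h₀`
from at least one of them, since two zero divergences would force equal laws. It converts
information about a wrong champion into information about the truth. -/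
lemma SensingModel.DivBounds.div_le {dmin dmax : ℝ} (hd : M.DivBounds dmin dmax)
    (hKL : M.FiniteKL) (a : A) (h₀ i g : H) :
    M.div a i g ≤ dmax / dmin * (M.div a h₀ i + M.div a h₀ g) := by
  have hpos := hd.pos
  have hnn := hd.nonneg
  have h1 := M.div_nonneg a h₀ i
  have h2 := M.div_nonneg a h₀ g
  rcases hd.eq_zero_or_le a i g with h0 | h0
  · rw [h0]
    positivity
  have h3 : dmin ≤ M.div a h₀ i + M.div a h₀ g := by
    rcases hd.eq_zero_or_le a h₀ i with h4 | h4
    · rcases hd.eq_zero_or_le a h₀ g with h5 | h5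
      · have h6 := ((hKL.div_eq_zero_iff a h₀ i).1 h4).symm.trans
          ((hKL.div_eq_zero_iff a h₀ g).1 h5)
        rw [(hKL.div_eq_zero_iff a i g).2 h6] at h0
        linarith
      · linarith
    · linarith
  calc M.div a i g ≤ dmax := hd.le a i g
    _ = dmax / dmin * dmin := by field_simp
    _ ≤ _ := by gcongr

lemma exists_pos_forall_eq_zero_or_le {ι : Type*} [Finite ι] {f : ι → ℝ} (hf : ∀ p, 0 ≤ f p) :
    ∃ d > 0, ∀ p, f p = 0 ∨ d ≤ f p := by
  rcases {p | f p ≠ 0}.eq_empty_or_nonempty with h | h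
  · exact ⟨1, one_pos, fun p => Or.inl (by_contra fun hne => Set.notMem_empty p (h ▸ hne))⟩
  · obtain ⟨p, hp, hpmin⟩ := Set.exists_min_image {p | f p ≠ 0} f (Set.toFinite _) h
    exact ⟨f p, (hf p).lt_of_ne' hp, fun q => or_iff_not_imp_left.2 (hpmin q)⟩

lemma SensingModel.exists_divBounds [Finite H] [Finite A] (M : SensingModel H A O) :
    ∃ dmin dmax, M.DivBounds dmin dmax := by
  have hnn : ∀ p : A × H × H, 0 ≤ M.div p.1 p.2.1 p.2.2 := fun p => M.div_nonneg _ _ _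
  obtain ⟨d, hd, hd'⟩ := exists_pos_forall_eq_zero_or_le hnn
  obtain ⟨D, hD⟩ := (Set.finite_range fun p : A × H × H => M.div p.1 p.2.1 p.2.2).bddAbove
  exact ⟨d, max D 0, hd, le_max_right _ _, fun a h g => hd' (a, h, g),
    fun a h g => (hD ⟨(a, h, g), rfl⟩).trans (le_max_left _ _)⟩

variable [Fintype A]

lemma SensingModel.infoRate_le {i g : H} {S : Finset H} (hg : g ∈ S) (w : A → ℝ) :
    M.infoRate i S w ≤ ∑ a, w a * M.div a i g :=
  ciInf_le (Set.finite_range fun g : S => ∑ a, w a * M.div a i g).bddBelow ⟨g, hg⟩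

lemma SensingModel.le_infoRate {i : H} {S : Finset H} (hS : S.Nonempty) {w : A → ℝ} {y : ℝ}
    (h : ∀ g ∈ S, y ≤ ∑ a, w a * M.div a i g) : y ≤ M.infoRate i S w := by
  have := hS.to_subtype
  exact le_ciInf fun g => h g g.2

lemma uniform_mem_stdSimplex [Nonempty A] :
    (fun _ => 1 / (Fintype.card A : ℝ)) ∈ stdSimplex ℝ A := by
  refine ⟨fun _ => by positivity, ?_⟩
  rw [Finset.sum_const, Finset.card_univ, nsmul_eq_mul, mul_one_div_cancel]
  exact Nat.cast_ne_zero.2 Fintype.card_ne_zero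

lemma SensingModel.DivBounds.le_infoRate_uniform [Nonempty A] {dmin dmax : ℝ}
    (hd : M.DivBounds dmin dmax) (hid : M.Identifiable) {i : H} {S : Finset H} (hS : S.Nonempty)
    (hiS : ∀ g ∈ S, g ≠ i) :
    dmin / Fintype.card A ≤ M.infoRate i S fun _ => 1 / (Fintype.card A : ℝ) := by
  refine SensingModel.le_infoRate hS fun g hg => ?_
  obtain ⟨a, ha⟩ := hid i g (hiS g hg).symm
  have h1 : dmin ≤ M.div a i g := (hd.eq_zero_or_le a i g).resolve_left ha.ne'
  rw [← Finset.mul_sum, one_div_mul_eq_div]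
  gcongr
  exact h1.trans (Finset.single_le_sum (f := fun a => M.div a i g)
    (fun b _ => M.div_nonneg b i g) (Finset.mem_univ a))

/-- The maximizer beats the uniform allocation, which puts weight `1 / |A|` on an action that
separates `i` from `g`. -/
lemma SensingModel.DivBounds.le_oracleAllocations [Nonempty A] {dmin dmax : ℝ}
    (hd : M.DivBounds dmin dmax) (hid : M.Identifiable) {i g : H} {S : Finset H}
    (hiS : ∀ g ∈ S, g ≠ i) (hg : g ∈ S) {u : A → ℝ} (hu : u ∈ M.oracleAllocations i S) :
    dmin / Fintype.card A ≤ ∑ a, u a * M.div a i g :=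
  (hd.le_infoRate_uniform hid ⟨g, hg⟩ hiS).trans
    ((hu.2 uniform_mem_stdSimplex).trans (SensingModel.infoRate_le hg u))

/-- A minimum over fewer opponents is larger, so eliminations never push the rate below that of the
full set `T`. This is why `D₀` serves for all stages. -/
lemma SensingModel.oracleRate_le_of_mem [Nonempty A] {i g : H} {S T : Finset H} (hST : S ⊆ T)
    (hg : g ∈ S) {u : A → ℝ} (hu : u ∈ M.oracleAllocations i S) :
    M.oracleRate i T ≤ ∑ a, u a * M.div a i g := by
  refine csSup_le (Set.Nonempty.image _ ⟨_, uniform_mem_stdSimplex⟩) ?_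
  rintro _ ⟨w, hw, rfl⟩
  refine le_trans ?_ ((hu.2 hw).trans (SensingModel.infoRate_le hg u))
  exact SensingModel.le_infoRate ⟨g, hg⟩ fun g' hg' => SensingModel.infoRate_le (hST hg') w

lemma SensingModel.oracleRate_pos [Finite H] [Nonempty A] (hid : M.Identifiable) {i : H} {S : Finset H}
    (hS : S.Nonempty) (hiS : ∀ g ∈ S, g ≠ i) : 0 < M.oracleRate i S := by
  obtain ⟨dmin, dmax, hd⟩ := M.exists_divBounds
  have h1 := hd.le_infoRate_uniform hid hS hiS
  refine lt_of_lt_of_le (div_pos hd.pos (by positivity)) (h1.trans (le_csSup ?_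
    ⟨_, uniform_mem_stdSimplex, rfl⟩))
  obtain ⟨g, hg⟩ := hS
  refine ⟨dmax, ?_⟩
  rintro _ ⟨w, hw, rfl⟩
  calc M.infoRate i S w ≤ ∑ a, w a * M.div a i g := SensingModel.infoRate_le hg w
    _ ≤ ∑ a, w a * dmax :=
      Finset.sum_le_sum fun a _ => mul_le_mul_of_nonneg_left (hd.le a i g) (hw.1 a)
    _ = dmax := by rw [← Finset.sum_mul, hw.2, one_mul]

end Rates

/-! ### Decomposition of log-likelihood ratios into noise and information -/

section InfoSum

variable {H A O : Type*} [MeasurableSpace O] {M : SensingModel H A O} {h₀ : H}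

/-- The information `∑_{k ≤ t} d_{A_k}(h, g)` collected in the first `t` rounds. -/
noncomputable def infoSum (M : SensingModel H A O) (h : H) (x : Path H A O) (t : ℕ) (g : H) : ℝ :=
  ∑ k ∈ Finset.Icc 1 t, M.div (x.act k) h g

lemma llRatio_eq_add_infoSum (M : SensingModel H A O) (h₀ : H) (x : Path H A O) (t : ℕ) (g : H) :
    llRatio M x t h₀ g = pathSum (M.centredIncr h₀ g) x t + infoSum M h₀ x t g := by
  rw [llRatio_eq_pathSum, pathSum, pathSum, infoSum, ← Finset.sum_add_distrib]
  exact Finset.sum_congr rfl fun k _ => by rw [SensingModel.centredIncr]; ring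

lemma infoSum_self (t : ℕ) : infoSum M h₀ x t h₀ = 0 := by
  simp [infoSum, SensingModel.div_self]

end InfoSum

/-- The number of rounds with champion `i` is controlled if it is so at the last such round after
the time `r`. -/
lemma champCount_le_of_last {H A O : Type*} {x : Path H A O} {r C : ℝ} {f : ℕ → ℝ} {t : ℕ} (hr : 0 ≤ r) (hf : 0 ≤ f t)
    (hC : 0 ≤ C) (hmono : ∀ s, 1 ≤ s → s ≤ t → f s ≤ f t) {i : H}
    (h : ∀ s, 1 ≤ s → s ≤ t → x.champ s = i → r ≤ s → champCount x s i ≤ C * f s) :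
    champCount x t i ≤ r + C * f t := by
  have hnn : 0 ≤ C * f t := mul_nonneg hC hf
  rcases champCount_eq_zero_or (x := x) t i with h0 | ⟨s, h1, h2, h3, h4⟩
  · rw [h0, Nat.cast_zero]
    linarith
  rw [h4]
  rcases le_total r s with hrs | hrs
  · have := mul_le_mul_of_nonneg_left (hmono s h1 h2) hC
    linarith [h s h1 h2 h3 hrs]
  · have : (champCount x s i : ℝ) ≤ s := by exact_mod_cast champCount_le s i
    linarith

/-! ### Pathwise bounds on the number of rounds before stopping -/

section PathBounds

variable {H A O : Type*} [Fintype H] [Fintype A] [MeasurableSpace O] {M : SensingModel H A O}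
  {h₀ : H} {β : ℕ → ℝ} {η : ℝ} {x : Path H A O} {dmin dmax : ℝ}

/-- A rate guaranteed in all rounds with champion `i` turns into collected information. -/
lemma FollowsElimTaS.mul_champCount_le (hx : FollowsElimTaS M β η x)
    (hη : η ∈ Set.Icc (0 : ℝ) 1) (hd : M.DivBounds dmin dmax) {t : ℕ} (ht : 1 ≤ t)
    (hτ : (t : ℕ∞) < stopTime M β x) {i g : H} {r : ℝ}
    (hr : ∀ s, 1 ≤ s → s ≤ t → x.champ s = i → r ≤ ∑ a, x.oracle s a * M.div a i g) :
    r * champCount x t i ≤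
      infoSum M i x t g + 2 * (Fintype.card A) ^ 2 * dmax * growth t := by
  classical
  have h1 : r * champCount x t i ≤
      ∑ s ∈ Finset.Icc 1 t, ∑ a, x.oracle s a * M.div a i g := by
    rw [champCount, mul_comm, ← nsmul_eq_mul, ← Finset.sum_const, Finset.sum_filter]
    refine Finset.sum_le_sum fun s hs => ?_
    rw [Finset.mem_Icc] at hs
    split_ifs with h
    · exact hr s hs.1 hs.2 h
    · have hs' : (s : ℕ∞) < stopTime M β x := lt_of_le_of_lt (by exact_mod_cast hs.2) hτ
      exact Finset.sum_nonneg fun a _ =>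
        mul_nonneg ((hx.oracle_mem s hs').1.1 a) (M.div_nonneg _ _ _)
  have h2 := hx.sum_oracle_le hη hτ (f := fun a => M.div a i g) fun a => M.div_nonneg _ _ _
  have h3 : ∑ a, M.div a i g ≤ Fintype.card A * dmax := by
    refine (Finset.sum_le_sum fun a _ => hd.le a i g).trans (le_of_eq ?_)
    simp
  have ht' : (1 : ℝ) ≤ t := by exact_mod_cast ht
  have h4 : 1 + Real.sqrt t ≤ 2 * growth t := by
    linarith [one_le_growth ht', sqrt_le_growth (t := (t : ℝ)) (by linarith)]
  have h5 : (∑ a, M.div a i g) * (Fintype.card A * (1 + Real.sqrt t)) ≤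
      (Fintype.card A * dmax) * (Fintype.card A * (2 * growth t)) := by
    have := hd.nonneg
    gcongr
  rw [infoSum]
  linarith

/-- Active sets only shrink, so `g` was an active opponent in every earlier round with champion `i`,
and each of those oracle allocations had a positive rate against it. -/
lemma FollowsElimTaS.mul_champCount_le_of_mem_activeSet [Nonempty A]
    (hx : FollowsElimTaS M β η x) (hη : η ∈ Set.Icc (0 : ℝ) 1) (hKL : M.FiniteKL)
    (hid : M.Identifiable) (hd : M.DivBounds dmin dmax) {t : ℕ} (ht : 1 ≤ t)
    (hτ : (t : ℕ∞) < stopTime M β x) {i g : H} (hg : g ∈ activeSet M β x t i) :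
    dmin / Fintype.card A * champCount x t i ≤
      dmax / dmin * (infoSum M h₀ x t i + infoSum M h₀ x t g) +
        2 * (Fintype.card A) ^ 2 * dmax * growth t := by
  have h1 := hx.mul_champCount_le hη hd ht hτ (i := i) (g := g) (r := dmin / Fintype.card A) (by
    intro s _ hst hsi
    have hs' : (s : ℕ∞) < stopTime M β x := lt_of_le_of_lt (by exact_mod_cast hst) hτ
    have hu := hx.oracle_mem s hs'
    rw [hsi] at hu
    exact hd.le_oracleAllocations hid (fun g' hg' => (mem_activeSet.1 hg').1)
      (activeSet_anti hst i hg) hu)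
  have h2 : infoSum M i x t g ≤ dmax / dmin * (infoSum M h₀ x t i + infoSum M h₀ x t g) := by
    simp only [infoSum]
    rw [← Finset.sum_add_distrib, Finset.mul_sum]
    exact Finset.sum_le_sum fun k _ => hd.div_le hKL (x.act k) h₀ i g
  linarith

/-- From time `r` on, the centred log-likelihood ratios of `h₀` are at most `B √(t log (e + t))`. -/
def ConcentratedFrom (M : SensingModel H A O) (h₀ : H) (B r : ℝ) (x : Path H A O) : Prop :=
  ∀ t : ℕ, 1 ≤ t → r ≤ t → ∀ g, |pathSum (M.centredIncr h₀ g) x t| ≤ B * growth t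

/-- The champion's likelihood is at least that of `h₀`, so the information against it is masked by
noise. -/
lemma FollowsElimTaS.infoSum_champ_le (hx : FollowsElimTaS M β η x) {B r : ℝ}
    (hc : ConcentratedFrom M h₀ B r x) {t : ℕ} (ht : 1 ≤ t) (hr : r ≤ t) :
    infoSum M h₀ x t (x.champ t) ≤ B * growth t := by
  have h1 := hx.champ_mle t ht h₀
  have h2 := llRatio_eq_add_infoSum M h₀ x t (x.champ t)
  have h3 := (abs_le.1 (hc t ht hr (x.champ t))).1
  rw [llRatio] at h2
  linarith

/-- Whatever is eliminated, the number of rounds before stopping is of the order of the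
threshold. -/
theorem exists_round_le [Nonempty A] (hKL : M.FiniteKL) (hid : M.Identifiable) (h₀ : H) {B : ℝ}
    (hB : 0 ≤ B) :
    ∃ C : ℝ, 0 ≤ C ∧ ∀ (β : ℕ → ℝ) (η r : ℝ) (x : Path H A O),
      (∀ t, 0 ≤ β t) → (∀ s t, 1 ≤ s → s ≤ t → β s ≤ β t) → η ∈ Set.Icc (0 : ℝ) 1 → 0 ≤ r →
      FollowsElimTaS M β η x → ConcentratedFrom M h₀ B r x →
      ∀ t : ℕ, (t : ℕ∞) < stopTime M β x → (t : ℝ) ≤ C * (r + (β t + growth t)) := by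
  obtain ⟨dmin, dmax, hd⟩ := M.exists_divBounds
  have hd1 := hd.pos
  have hd2 := hd.nonneg
  set n : ℝ := (Fintype.card A : ℝ) with hn
  have hnpos : 0 < n := by rw [hn]; exact_mod_cast Fintype.card_pos
  set c : ℝ := n / dmin * (dmax / dmin * (1 + 2 * B) + 2 * n ^ 2 * dmax) with hc
  have hcnn : 0 ≤ c := by positivity
  refine ⟨Fintype.card H * (1 + c), by positivity, ?_⟩
  intro β η r x hβ hβm hη hr hx hconc t hτ
  have hcount : ∀ i, champCount x t i ≤ r + c * (β t + growth t) := by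
    intro i
    refine champCount_le_of_last (f := fun t => β t + growth t) hr
      (add_nonneg (hβ t) (growth_nonneg _)) hcnn (fun s h1 h2 => add_le_add (hβm s t h1 h2)
        (growth_mono (Nat.cast_nonneg s) (by exact_mod_cast h2))) ?_
    intro s hs hst hsi hrs
    have hτs : (s : ℕ∞) < stopTime M β x := lt_of_le_of_lt (by exact_mod_cast hst) hτ
    obtain ⟨g, hg⟩ := activeSet_champ_nonempty hs hτs
    rw [hsi] at hg
    have h1 := hx.mul_champCount_le_of_mem_activeSet (h₀ := h₀) hη hKL hid hd hs hτs hg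
    have h2 := hx.infoSum_champ_le hconc hs hrs
    rw [hsi] at h2
    -- As `i` is at least as likely as `h₀` and has not eliminated `g`, the ratio of `h₀` against
    -- `g` is below `β s` too.
    have h3 : infoSum M h₀ x s g ≤ β s + B * growth s := by
      have h4 := (mem_activeSet.1 hg).2 s hs le_rfl hsi
      have h5 := hx.champ_mle s hs h₀
      rw [hsi] at h5
      have h6 := llRatio_eq_add_infoSum M h₀ x s g
      have h7 := (abs_le.1 (hconc s hs hrs g)).1
      rw [llRatio] at h4 h6
      linarith
    have hgr := growth_nonneg s
    have hβs := hβ s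
    have h8 : dmin / n * champCount x s i ≤
        (dmax / dmin * (1 + 2 * B) + 2 * n ^ 2 * dmax) * (β s + growth s) := by
      have h9 : dmax / dmin * (infoSum M h₀ x s i + infoSum M h₀ x s g) ≤
          dmax / dmin * ((1 + 2 * B) * (β s + growth s)) := by
        gcongr
        nlinarith
      have h10 : 2 * n ^ 2 * dmax * growth s ≤ 2 * n ^ 2 * dmax * (β s + growth s) := by
        gcongr
        linarith
      linarith
    calc (champCount x s i : ℝ) = n / dmin * (dmin / n * champCount x s i) := by field_simp
      _ ≤ n / dmin * ((dmax / dmin * (1 + 2 * B) + 2 * n ^ 2 * dmax) * (β s + growth s)) := by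
          gcongr
      _ = c * (β s + growth s) := by rw [hc]; ring
  have hsum : (t : ℝ) = ∑ i, (champCount x t i : ℝ) := by
    exact_mod_cast (sum_champCount (x := x) t).symm
  have hnn := add_nonneg (hβ t) (growth_nonneg (t : ℝ))
  calc (t : ℝ) = ∑ i, (champCount x t i : ℝ) := hsum
    _ ≤ ∑ _i : H, (r + c * (β t + growth t)) := Finset.sum_le_sum fun i _ => hcount i
    _ = Fintype.card H * (r + c * (β t + growth t)) := by
        rw [Finset.sum_const, Finset.card_univ, nsmul_eq_mul]
    _ ≤ Fintype.card H * ((1 + c) * (r + (β t + growth t))) := by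
        gcongr
        nlinarith
    _ = _ := by ring

/-- If no other hypothesis eliminates `h₀`, then information about `h₀` is collected at the oracle
rate up to lower-order terms. -/
theorem exists_oracleRate_mul_round_le [Nonempty A] (hKL : M.FiniteKL) (hid : M.Identifiable)
    (h₀ : H) {B : ℝ} (hB : 0 ≤ B) (hD : 0 ≤ M.oracleRate h₀ (opponents h₀)) :
    ∃ C : ℝ, 0 ≤ C ∧ ∀ (β : ℕ → ℝ) (η r : ℝ) (x : Path H A O),
      (∀ t, 0 ≤ β t) → (∀ s t, 1 ≤ s → s ≤ t → β s ≤ β t) → η ∈ Set.Icc (0 : ℝ) 1 → 0 ≤ r →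
      FollowsElimTaS M β η x → ConcentratedFrom M h₀ B r x →
      (∀ i, i ≠ h₀ → ∀ s, 1 ≤ s → llRatio M x s i h₀ < β s) →
      ∀ t : ℕ, (t : ℕ∞) < stopTime M β x →
        M.oracleRate h₀ (opponents h₀) * t ≤ β t + C * (r + growth t) := by
  obtain ⟨dmin, dmax, hd⟩ := M.exists_divBounds
  have hd1 := hd.pos
  have hd2 := hd.nonneg
  set D := M.oracleRate h₀ (opponents h₀) with hDdef
  set n : ℝ := (Fintype.card A : ℝ) with hn
  have hnpos : 0 < n := by rw [hn]; exact_mod_cast Fintype.card_pos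
  set c : ℝ := n / dmin * (dmax / dmin * B + 2 * n ^ 2 * dmax) with hc
  have hcnn : 0 ≤ c := by positivity
  set c' : ℝ := B + 2 * n ^ 2 * dmax with hc'
  have hc'nn : 0 ≤ c' := by positivity
  refine ⟨D * (Fintype.card H * (1 + c) + 1) + c', by positivity, ?_⟩
  intro β η r x hβ hβm hη hr hx hconc hno t hτ
  have hgt := growth_nonneg (t : ℝ)
  have hgmono : ∀ s : ℕ, s ≤ t → growth s ≤ growth t := fun s h2 =>
    growth_mono (Nat.cast_nonneg s) (by exact_mod_cast h2)
  have hcount : ∀ i, i ≠ h₀ → champCount x t i ≤ r + c * growth t := by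
    intro i hi
    refine champCount_le_of_last (f := fun t => growth t) hr hgt hcnn
      (fun s _ h2 => hgmono s h2) ?_
    intro s hs hst hsi hrs
    have hτs : (s : ℕ∞) < stopTime M β x := lt_of_le_of_lt (by exact_mod_cast hst) hτ
    -- The gain over the crude bound: with `h₀` itself as the active opponent, its own information
    -- term vanishes and no threshold enters the count.
    have hmem : h₀ ∈ activeSet M β x s i :=
      mem_activeSet.2 ⟨hi.symm, fun k hk _ _ => hno i hi k hk⟩
    have h1 := hx.mul_champCount_le_of_mem_activeSet (h₀ := h₀) hη hKL hid hd hs hτs hmem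
    have h2 := hx.infoSum_champ_le hconc hs hrs
    rw [hsi] at h2
    rw [infoSum_self, add_zero] at h1
    have h8 : dmin / n * champCount x s i ≤
        (dmax / dmin * B + 2 * n ^ 2 * dmax) * growth s := by
      have h9 : dmax / dmin * infoSum M h₀ x s i ≤ dmax / dmin * (B * growth s) := by gcongr
      linarith
    calc (champCount x s i : ℝ) = n / dmin * (dmin / n * champCount x s i) := by field_simp
      _ ≤ n / dmin * ((dmax / dmin * B + 2 * n ^ 2 * dmax) * growth s) := by gcongr
      _ = c * growth s := by rw [hc]; ring
  set w : ℝ := Fintype.card H * ((1 + c) * (r + growth t)) with hw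
  have hwnn : 0 ≤ w := by positivity
  have hsum : (t : ℝ) ≤ champCount x t h₀ + w := by
    classical
    have h1 : (t : ℝ) = ∑ i, (champCount x t i : ℝ) := by
      exact_mod_cast (sum_champCount (x := x) t).symm
    rw [← Finset.add_sum_erase _ _ (Finset.mem_univ h₀)] at h1
    have h2 : ∑ i ∈ Finset.univ.erase h₀, (champCount x t i : ℝ) ≤
        ∑ _i : H, (1 + c) * (r + growth t) := by
      refine (Finset.sum_le_sum fun i hi => ?_).trans
        (Finset.sum_le_sum_of_subset_of_nonneg (Finset.erase_subset _ _)
          fun _ _ _ => by positivity)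
      have := hcount i (Finset.ne_of_mem_erase hi)
      nlinarith
    rw [Finset.sum_const, Finset.card_univ, nsmul_eq_mul] at h2
    linarith
  have hDt : D * t ≤ D * champCount x t h₀ + D * w := by
    rw [← mul_add]
    exact mul_le_mul_of_nonneg_left hsum hD
  have hmain : D * champCount x t h₀ ≤ β t + D * r + c' * growth t := by
    have hDr : 0 ≤ D * r := mul_nonneg hD hr
    have hcg : 0 ≤ c' * growth t := mul_nonneg hc'nn hgt
    rcases champCount_eq_zero_or (x := x) t h₀ with h0 | ⟨s, hs, hst, hsi, h4⟩
    · rw [h0, Nat.cast_zero, mul_zero]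
      linarith [hβ t]
    rw [h4]
    rcases le_total r s with hrs | hrs
    · have hτs : (s : ℕ∞) < stopTime M β x := lt_of_le_of_lt (by exact_mod_cast hst) hτ
      obtain ⟨g, hg⟩ := activeSet_champ_nonempty hs hτs
      rw [hsi] at hg
      have h1 := hx.mul_champCount_le hη hd hs hτs (i := h₀) (g := g) (r := D) (by
        intro k _ hks hki
        have hk' : (k : ℕ∞) < stopTime M β x := lt_of_le_of_lt (by exact_mod_cast hks) hτs
        have hu := hx.oracle_mem k hk'
        rw [hki] at hu
        exact SensingModel.oracleRate_le_of_mem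
          (fun g' hg' => mem_opponents.2 (mem_activeSet.1 hg').1) (activeSet_anti hks h₀ hg) hu)
      have h2 := (mem_activeSet.1 hg).2 s hs le_rfl hsi
      rw [llRatio_eq_add_infoSum] at h2
      have h3 := (abs_le.1 (hconc s hs hrs g)).1
      have h5 := hβm s t hs hst
      have h6 := mul_le_mul_of_nonneg_left (hgmono s hst) hc'nn
      rw [hc'] at h6 ⊢
      linarith
    · have h1 : (champCount x s h₀ : ℝ) ≤ s := by exact_mod_cast champCount_le s h₀
      have h2 := mul_le_mul_of_nonneg_left (h1.trans hrs) hD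
      linarith [hβ t]
  have hc'r : 0 ≤ c' * r := mul_nonneg hc'nn hr
  have hDg : 0 ≤ D * growth t := mul_nonneg hD hgt
  rw [hw] at hDt
  nlinarith

end PathBounds

/-! ### Solving the implicit inequalities for `t` -/

section Inversion

lemma exists_log_exp_one_add_le {ε : ℝ} (hε : 0 < ε) :
    ∃ C : ℝ, 0 ≤ C ∧ ∀ t : ℝ, 0 ≤ t → Real.log (Real.exp 1 + t) ≤ ε * t + C := by
  refine ⟨max (ε * Real.exp 1 - 1 - Real.log ε) 0, le_max_right _ _, fun t ht => ?_⟩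
  have hpos : 0 < Real.exp 1 + t := by positivity
  have h := Real.log_le_sub_one_of_pos (mul_pos hε hpos)
  rw [Real.log_mul hε.ne' hpos.ne'] at h
  have := le_max_left (ε * Real.exp 1 - 1 - Real.log ε) 0
  linarith

lemma exists_growth_le {ε : ℝ} (hε : 0 < ε) :
    ∃ C : ℝ, 0 ≤ C ∧ ∀ t : ℝ, 0 ≤ t → growth t ≤ ε * t + C := by
  obtain ⟨C, hC, h⟩ := exists_log_exp_one_add_le (ε := (ε / 2) ^ 2) (by positivity)
  refine ⟨C / (ε / 2), by positivity, fun t ht => ?_⟩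
  have hl := one_le_log_exp_one_add ht
  set l := Real.log (Real.exp 1 + t) with hldef
  have h1 : growth t ≤ ε / 2 * t + l / (ε / 2) := by
    refine Real.sqrt_le_iff.2 ⟨by positivity, ?_⟩
    have : (ε / 2 * t + l / (ε / 2)) ^ 2 =
        (ε / 2 * t) ^ 2 + (l / (ε / 2)) ^ 2 + 2 * (t * l) := by field_simp; ring
    rw [this]
    have h2 : 0 ≤ t * l := by positivity
    nlinarith [sq_nonneg (ε / 2 * t), sq_nonneg (l / (ε / 2))]
  have h2 : l / (ε / 2) ≤ ε / 2 * t + C / (ε / 2) := by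
    rw [div_le_iff₀ (by positivity)]
    refine (h t ht).trans (le_of_eq ?_)
    field_simp
  linarith

lemma log_natCast_le (t : ℕ) : Real.log t ≤ Real.log (Real.exp 1 + t) := by
  rcases Nat.eq_zero_or_pos t with rfl | h
  · simp
  · exact Real.log_le_log (by exact_mod_cast h) (by linarith [Real.exp_pos 1])

lemma exists_log_add_growth_le {b : ℝ} (hb : 0 ≤ b) {ε : ℝ} (hε : 0 < ε) :
    ∃ C : ℝ, 0 ≤ C ∧ ∀ t : ℕ, b * Real.log t + growth t ≤ ε * t + C := by
  obtain ⟨C₁, hC₁, h₁⟩ := exists_log_exp_one_add_le (ε := ε / (2 * (b + 1))) (by positivity)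
  obtain ⟨C₂, hC₂, h₂⟩ := exists_growth_le (ε := ε / 2) (by positivity)
  refine ⟨b * C₁ + C₂, by positivity, fun t => ?_⟩
  have ht : (0 : ℝ) ≤ t := Nat.cast_nonneg t
  have h3 := mul_le_mul_of_nonneg_left ((log_natCast_le t).trans (h₁ t ht)) hb
  have h4 : b * (ε / (2 * (b + 1))) ≤ ε / 2 := by
    rw [mul_div_assoc', div_le_div_iff₀ (by positivity) (by positivity)]
    nlinarith
  have h5 := mul_le_mul_of_nonneg_right h4 ht
  linarith [h₂ t ht]

lemma log_le_of_le_mul {K L r t : ℝ} (hK : 1 ≤ K) (hL : 0 ≤ L) (hr : 1 ≤ r) (ht : 0 ≤ t)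
    (h : t ≤ K * (L + r)) :
    Real.log (Real.exp 1 + t) ≤ Real.log (Real.exp 1 + L) + (Real.log (2 * K) + r) := by
  have he : 1 ≤ Real.exp 1 := Real.one_le_exp (by norm_num)
  have h1 : Real.exp 1 + t ≤ 2 * K * (Real.exp 1 + L) * r := by
    have hKr : 1 ≤ K * r := one_le_mul_of_one_le_of_one_le hK hr
    have h2 : Real.exp 1 ≤ K * r * Real.exp 1 := le_mul_of_one_le_left (by positivity) hKr
    have h3 : K * r ≤ K * r * Real.exp 1 := le_mul_of_one_le_right (by positivity) he
    have h4 : K * L ≤ K * L * r := le_mul_of_one_le_right (by positivity) hr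
    have h5 : 0 ≤ K * L * r := by positivity
    nlinarith
  have h2 := Real.log_le_log (by positivity) h1
  rw [Real.log_mul (by positivity) (by positivity), Real.log_mul (by positivity) (by positivity)]
    at h2
  linarith [Real.log_le_sub_one_of_pos (show 0 < r by linarith)]

/-- If `r ≤ L`, then `t = O(L)` and the noise scale in `t` is that in `L`; otherwise `t = O(r)` and
a linear bound suffices. -/
lemma exists_growth_le_of_le_mul {K : ℝ} (hK : 1 ≤ K) :
    ∃ C : ℝ, 0 ≤ C ∧ ∀ L r t : ℝ, 0 ≤ L → 1 ≤ r → 0 ≤ t → t ≤ K * (L + r) →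
      growth t ≤ C * (Real.sqrt (L * Real.log (Real.exp 1 + L)) + r) := by
  obtain ⟨C₁, hC₁, h₁⟩ := exists_growth_le one_pos
  have hlog : 0 ≤ Real.log (2 * K) := Real.log_nonneg (by linarith)
  set C₂ := Real.sqrt (2 * K * (Real.log (2 * K) + 1)) with hC₂
  refine ⟨2 * K + C₁ + C₂, by positivity, fun L r t hL hr ht h => ?_⟩
  have hl := one_le_log_exp_one_add hL
  set l := Real.log (Real.exp 1 + L) with hldef
  have hs := Real.sqrt_nonneg (L * l)
  have hC₂nn : 0 ≤ C₂ := Real.sqrt_nonneg _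
  rcases le_total r L with hrL | hrL
  · have h2 : t ≤ 2 * K * L := h.trans (by nlinarith)
    have h3 : Real.log (Real.exp 1 + 2 * K * L) ≤ (Real.log (2 * K) + 1) * l := by
      have h4 : Real.exp 1 + 2 * K * L ≤ 2 * K * (Real.exp 1 + L) := by
        nlinarith [Real.exp_pos 1]
      have h5 := Real.log_le_log (by positivity) h4
      rw [Real.log_mul (by positivity) (by positivity)] at h5
      nlinarith
    have h4 : growth t ≤ C₂ * Real.sqrt (L * l) := by
      refine (growth_mono ht h2).trans ?_
      rw [hC₂, ← Real.sqrt_mul (by positivity), growth]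
      refine Real.sqrt_le_sqrt ?_
      calc 2 * K * L * Real.log (Real.exp 1 + 2 * K * L)
          ≤ 2 * K * L * ((Real.log (2 * K) + 1) * l) := by gcongr
        _ = _ := by ring
    have h5 : 0 ≤ (2 * K + C₁) * Real.sqrt (L * l) := by positivity
    have h6 : 0 ≤ (2 * K + C₁ + C₂) * r := by positivity
    nlinarith
  · have h2 : t ≤ 2 * K * r := h.trans (by nlinarith)
    have h3 := h₁ t ht
    have h4 : C₁ ≤ C₁ * r := le_mul_of_one_le_right hC₁ hr
    have h5 : 0 ≤ C₂ * r := by positivity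
    have h6 : 0 ≤ (2 * K + C₁ + C₂) * Real.sqrt (L * l) := by positivity
    nlinarith

end Inversion

/-! ### Explicit bounds on the stopping time -/

section StoppingBounds

variable {H A O : Type*} [Fintype H] [Fintype A] [MeasurableSpace O] {M : SensingModel H A O}
  {b c α δ : ℝ}

lemma log_one_div_nonneg (hδ : δ ∈ Set.Ioo (0 : ℝ) 1) : 0 ≤ Real.log (1 / δ) :=
  Real.log_nonneg (one_le_one_div hδ.1 hδ.2.le)

lemma elimThreshold_nonneg (hb : 0 ≤ b) (hc : 0 ≤ c) (hα : 0 ≤ α)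
    (hδ : δ ∈ Set.Ioo (0 : ℝ) 1) (t : ℕ) : 0 ≤ elimThreshold b c α δ t := by
  have h1 := log_one_div_nonneg hδ
  have h2 := Real.log_natCast_nonneg t
  unfold elimThreshold
  positivity

lemma elimThreshold_mono (hb : 0 ≤ b) {s t : ℕ} (hs : 1 ≤ s) (hst : s ≤ t) :
    elimThreshold b c α δ s ≤ elimThreshold b c α δ t := by
  unfold elimThreshold
  have : Real.log s ≤ Real.log t :=
    Real.log_le_log (by exact_mod_cast hs) (by exact_mod_cast hst)
  gcongr

/-- Pathwise bounds on the stopping time: a crude one, and a sharp one if `h₀` is not eliminated. -/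
theorem exists_stopping_bounds [Nonempty A] (hKL : M.FiniteKL) (hid : M.Identifiable) (h₀ : H)
    {B : ℝ} (hB : 0 ≤ B) (hb : 0 ≤ b) (hc : 0 ≤ c) (hD : 0 < M.oracleRate h₀ (opponents h₀)) :
    ∃ C : ℝ, 0 < C ∧ ∀ α ∈ Set.Ioc (0 : ℝ) 1, ∀ δ ∈ Set.Ioo (0 : ℝ) 1,
      ∀ η ∈ Set.Icc (0 : ℝ) 1, ∀ r : ℝ, 1 ≤ r → ∀ x : Path H A O,
      FollowsElimTaS M (elimThreshold b c α δ) η x → ConcentratedFrom M h₀ B r x →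
      ∀ t : ℕ, (t : ℕ∞) < stopTime M (elimThreshold b c α δ) x →
        t ≤ C * (α * Real.log (1 / δ)) + C * r ∧
        ((∀ i s, llRatio M x s i h₀ < α * Real.log (1 / δ)) →
          t ≤ α * Real.log (1 / δ) / M.oracleRate h₀ (opponents h₀) +
            b / M.oracleRate h₀ (opponents h₀) * Real.log (Real.exp 1 + Real.log (1 / δ)) +
            C * Real.sqrt (Real.log (1 / δ) * Real.log (Real.exp 1 + Real.log (1 / δ))) +
            C * r) := by
  obtain ⟨C₁, hC₁, h₁⟩ := exists_round_le hKL hid h₀ hB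
  obtain ⟨C₂, hC₂, h₂⟩ := exists_oracleRate_mul_round_le hKL hid h₀ hB hD.le
  -- This slope makes `C₁ * ε ≤ 1 / 2`, so the `t`-dependent terms are absorbed on the left.
  obtain ⟨C₃, hC₃, h₃⟩ := exists_log_add_growth_le hb (ε := 1 / (2 * (C₁ + 1))) (by positivity)
  set D := M.oracleRate h₀ (opponents h₀) with hDdef
  set K : ℝ := 2 * C₁ * (1 + c + C₃) + 1 with hKdef
  have hK : 1 ≤ K := le_add_of_nonneg_left (by positivity)
  obtain ⟨C₄, hC₄, h₄⟩ := exists_growth_le_of_le_mul hK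
  have hlogK : 0 ≤ Real.log (2 * K) := Real.log_nonneg (by linarith)
  set Q : ℝ := b * (Real.log (2 * K) + 1) + c + C₂ * (1 + C₄) with hQ
  have hQnn : 0 ≤ Q := by positivity
  refine ⟨K + Q / D, by positivity, ?_⟩
  intro α hα δ hδ η hη r hr x hx hconc t hτ
  have hL := log_one_div_nonneg hδ
  set L := Real.log (1 / δ) with hLdef
  have hαL : 0 ≤ α * L := mul_nonneg hα.1.le hL
  have hαL' : α * L ≤ L := mul_le_of_le_one_left hL hα.2
  have ht : (0 : ℝ) ≤ t := Nat.cast_nonneg t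
  have hβt : elimThreshold b c α δ t = α * L + (b * Real.log t + c) := rfl
  have hcrude : (t : ℝ) ≤ K * (α * L + r) := by
    have h5 := h₁ _ η r x (elimThreshold_nonneg hb hc hα.1.le hδ)
      (fun s t hs hst => elimThreshold_mono hb hs hst) hη (by linarith) hx hconc t hτ
    rw [hβt] at h5
    have h6 : C₁ * (b * Real.log t + growth t) ≤ C₁ * (1 / (2 * (C₁ + 1)) * t + C₃) :=
      mul_le_mul_of_nonneg_left (h₃ t) hC₁
    have h7 : C₁ * (1 / (2 * (C₁ + 1))) ≤ 1 / 2 := by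
      rw [mul_one_div, div_le_div_iff₀ (by positivity) (by positivity)]
      linarith
    have h8 := mul_le_mul_of_nonneg_right h7 ht
    have h9 : (t : ℝ) ≤ 2 * C₁ * (r + α * L + (c + C₃)) := by nlinarith
    have h10 : r + α * L + (c + C₃) ≤ (1 + c + C₃) * (α * L + r) := by
      have : c + C₃ ≤ (c + C₃) * (α * L + r) :=
        le_mul_of_one_le_right (by positivity) (by linarith)
      linarith
    have h11 := mul_le_mul_of_nonneg_left h10 (show 0 ≤ 2 * C₁ by positivity)
    rw [hKdef]
    nlinarith
  have hQD : 0 ≤ Q / D := by positivity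
  refine ⟨?_, fun hno => ?_⟩
  · have : 0 ≤ Q / D * (α * L + r) := by positivity
    linarith
  -- In lower-order terms `αL` may be relaxed to `L`; the crude bound itself keeps `αL`, to be
  -- matched with `exp (-αL)`.
  have hcrude' : (t : ℝ) ≤ K * (L + r) := hcrude.trans (by gcongr)
  have h5 := h₂ _ η r x (elimThreshold_nonneg hb hc hα.1.le hδ)
    (fun s t hs hst => elimThreshold_mono hb hs hst) hη (by linarith) hx hconc
    (fun i _ s hs => (hno i s).trans_le (by
      have := mul_nonneg hb (Real.log_natCast_nonneg s)
      rw [elimThreshold]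
      linarith)) t hτ
  rw [hβt] at h5
  have h6 := mul_le_mul_of_nonneg_left
    ((log_natCast_le t).trans (log_le_of_le_mul hK hL hr ht hcrude')) hb
  have h7 := mul_le_mul_of_nonneg_left (h₄ L r t hL hr ht hcrude') hC₂
  set l := Real.log (Real.exp 1 + L) with hldef
  set S := Real.sqrt (L * l) with hS
  have hSnn : 0 ≤ S := Real.sqrt_nonneg _
  have h8 : D * t ≤ α * L + b * l + Q * S + Q * r := by
    have e1 : b * Real.log (2 * K) ≤ b * Real.log (2 * K) * r :=
      le_mul_of_one_le_right (by positivity) hr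
    have e2 : c ≤ c * r := le_mul_of_one_le_right hc hr
    have e3 : C₂ * C₄ * S ≤ Q * S := by
      refine mul_le_mul_of_nonneg_right ?_ hSnn
      have : 0 ≤ b * (Real.log (2 * K) + 1) := by positivity
      rw [hQ]
      linarith
    rw [hQ] at e3 ⊢
    nlinarith
  have h9 : (t : ℝ) ≤ (α * L + b * l + Q * S + Q * r) / D := by
    rw [le_div_iff₀ hD]
    linarith
  have h10 : (α * L + b * l + Q * S + Q * r) / D =
      α * L / D + b / D * l + Q / D * S + Q / D * r := by ring
  have h11 : 0 ≤ K * S := by positivity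
  have h12 : 0 ≤ K * r := by positivity
  linarith

/-- The path rules bind only before stopping, so the last usable round is `τ - 1`; hence the extra
`1`. Finiteness of `τ` comes along. -/
lemma ENat_toENNReal_le_ofReal_add_one {n : ℕ∞} {y : ℝ} (hy : 0 ≤ y)
    (h : ∀ t : ℕ, (t : ℕ∞) < n → (t : ℝ) ≤ y) : (n : ℝ≥0∞) ≤ ENNReal.ofReal (y + 1) := by
  induction n using ENat.recTopCoe with
  | top =>
    obtain ⟨k, hk⟩ := exists_nat_gt y
    exact absurd (h k (ENat.natCast_lt_top k)) (not_le.2 hk)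
  | coe n =>
    rw [ENat.toENNReal_coe, ← ENNReal.ofReal_natCast]
    refine ENNReal.ofReal_le_ofReal ?_
    rcases n with _ | n
    · push_cast
      linarith
    · push_cast
      linarith [h n (by exact_mod_cast Nat.lt_succ_self n)]

end StoppingBounds

/-! ### From pathwise bounds to the expectation -/

lemma concentratedFrom_toReal_concentrationTime {H A O Ω : Type*} [MeasurableSpace O]
    {M : SensingModel H A O} {h₀ : H} {v : ℝ≥0} {X : Ω → Path H A O} {ω : Ω}
    (h : concentrationTime M h₀ v X ω ≠ ⊤) :
    ConcentratedFrom M h₀ (Real.sqrt (6 * (v + 1))) (concentrationTime M h₀ v X ω).toReal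
      (X ω) := by
  intro t ht hr g
  by_contra hlt
  refine not_mem_deviationSet_of_concentrationTime_le ht ?_ ⟨g, not_le.1 hlt⟩
  rw [← ENNReal.ofReal_toReal h, ← ENNReal.ofReal_natCast]
  exact ENNReal.ofReal_le_ofReal hr

lemma one_le_toReal_concentrationTime {H A O Ω : Type*} [MeasurableSpace O]
    {M : SensingModel H A O} {h₀ : H} {v : ℝ≥0} {X : Ω → Path H A O} {ω : Ω}
    (h : concentrationTime M h₀ v X ω ≠ ⊤) : 1 ≤ (concentrationTime M h₀ v X ω).toReal := by
  rw [← ENNReal.toReal_one]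
  exact ENNReal.toReal_mono h le_self_add

/-- The truncated mean of a random variable that is at most `y₁` up to a multiple of an integrable
remainder, except on a set of measure at most `ε`, where it is at most `y₂`. -/
lemma lintegral_indicator_le_of_ae_le {Ω : Type*} {mΩ : MeasurableSpace Ω} {P : Measure Ω}
    {T R : Ω → ℝ≥0∞} {E F : Set Ω} {y₁ y₂ k ε ρ : ℝ≥0∞} (hR : Measurable R)
    (hRint : ∫⁻ ω, R ω ∂P ≤ ρ) (hF : P F ≤ ε)
    (h₁ : ∀ᵐ ω ∂P, ω ∉ F → T ω ≤ y₁ + k * R ω) (h₂ : ∀ᵐ ω ∂P, T ω ≤ y₂ + k * R ω) :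
    ∫⁻ ω, E.indicator T ω ∂P ≤ y₁ * P E + (k * ρ + y₂ * ε) := by
  -- `F` is not assumed measurable; its measurable hull has the same measure.
  set F' := toMeasurable P F with hF'
  have hF'm : MeasurableSet F' := measurableSet_toMeasurable P F
  have hle : ∀ᵐ ω ∂P, E.indicator T ω ≤ E.indicator (fun _ => y₁) ω +
      (k * R ω + F'.indicator (fun _ => y₂) ω) := by
    filter_upwards [h₁, h₂] with ω hω₁ hω₂
    by_cases hE : ω ∈ E
    · rw [Set.indicator_of_mem hE, Set.indicator_of_mem hE]
      by_cases hωF : ω ∈ F'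
      · rw [Set.indicator_of_mem hωF, add_comm (k * R ω)]
        exact hω₂.trans le_add_self
      · rw [Set.indicator_of_notMem hωF, add_zero]
        exact hω₁ fun h => hωF (subset_toMeasurable P F h)
    · simp [Set.indicator_of_notMem hE]
  calc ∫⁻ ω, E.indicator T ω ∂P
      ≤ ∫⁻ ω, E.indicator (fun _ => y₁) ω + (k * R ω + F'.indicator (fun _ => y₂) ω) ∂P :=
        lintegral_mono_ae hle
    _ = ∫⁻ ω, E.indicator (fun _ => y₁) ω ∂P + (∫⁻ ω, k * R ω ∂P +
          ∫⁻ ω, F'.indicator (fun _ => y₂) ω ∂P) := by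
        have hm : Measurable fun ω => k * R ω + F'.indicator (fun _ => y₂) ω :=
          (hR.const_mul k).add (measurable_const.indicator hF'm)
        rw [lintegral_add_right _ hm,
          lintegral_add_left (hR.const_mul k)]
    _ ≤ y₁ * P E + (k * ρ + y₂ * ε) := by
        rw [lintegral_const_mul _ hR]
        gcongr
        · exact lintegral_indicator_const_le _ _
        · refine (lintegral_indicator_const_le _ _).trans ?_
          rw [hF', measure_toMeasurable]
          gcongr

end ElimTaS

theorem proposition1 {H A O : Type*} [Fintype H] [Nontrivial H] [Fintype A] [MeasurableSpace O]
    (M : ElimTaS.SensingModel H A O) (hKL : M.FiniteKL) (hid : M.Identifiable)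
    (h₀ : H) (v : ℝ≥0) (hsub : M.SubGaussianAt h₀ v)
    (b c : ℝ) (hb : 0 < b) (hc : 0 < c) (η : ℝ) (hη : η ∈ Set.Icc (0 : ℝ) 1)
    (σ : ElimTaS.ElimChain h₀) :
    ∃ C₁ C₂ C₃ : ℝ, 0 < C₁ ∧ 0 < C₂ ∧ 0 < C₃ ∧
      ∀ α ∈ Set.Ioc (0 : ℝ) 1, ∀ δ ∈ Set.Ioo (0 : ℝ) 1,
      ∀ (Ω : Type*) (mΩ : MeasurableSpace Ω) (P : Measure Ω) (_ : IsProbabilityMeasure P)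
        (ℱ : Filtration ℕ mΩ) (X : Ω → ElimTaS.Path H A O),
        ElimTaS.IsElimTaSRun M h₀ (ElimTaS.elimThreshold b c α δ) η P ℱ X →
        let β : ℕ → ℝ := ElimTaS.elimThreshold b c α δ
        let E : Set Ω := {ω | ElimTaS.OnChain M σ β (X ω)}
        let L : ℝ := Real.log (1 / δ)
        let D₀ : ℝ := M.oracleRate h₀ (ElimTaS.opponents h₀)
        ∫⁻ ω, E.indicator (fun ω => (ElimTaS.stopTime M β (X ω) : ℝ≥0∞)) ω ∂P ≤
          ENNReal.ofReal
            (P.real E *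
                (α * L / D₀ + b / D₀ * Real.log (Real.exp 1 + L)
                  + C₁ * Real.sqrt (L * Real.log (Real.exp 1 + L))
                  + C₂ * Real.log (Real.exp 1 + L) ^ 2)
              + C₃) := by
  obtain ⟨g₀, hg₀⟩ := exists_ne h₀
  have hA : Nonempty A := ⟨(hid h₀ g₀ hg₀.symm).choose⟩
  have hD : 0 < M.oracleRate h₀ (ElimTaS.opponents h₀) :=
    ElimTaS.SensingModel.oracleRate_pos hid ⟨g₀, ElimTaS.mem_opponents.2 hg₀⟩
      fun g hg => ElimTaS.mem_opponents.1 hg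
  obtain ⟨C, hC, hbound⟩ := ElimTaS.exists_stopping_bounds hKL hid h₀
    (Real.sqrt_nonneg (6 * ((v : ℝ) + 1))) hb.le hc.le hD
  obtain ⟨ρ, hρ, hρ'⟩ : ∃ ρ : ℝ, 0 ≤ ρ ∧ ElimTaS.concentrationBound H = ENNReal.ofReal ρ :=
    ⟨_, ENNReal.toReal_nonneg, (ENNReal.ofReal_toReal (ElimTaS.concentrationBound_ne_top H)).symm⟩
  -- The `log²` term is not needed, so any positive coefficient will do. In the last constant `(C +
  -- 1) * ρ` pays for the mean of `R` and `C * |H|` for the event `F`.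
  refine ⟨C, 1, (C + 1) * ρ + C * Fintype.card H + 1, hC, one_pos, by positivity, ?_⟩
  intro α hα δ hδ Ω mΩ P hP ℱ X hX β E L D₀
  have hL : 0 ≤ L := ElimTaS.log_one_div_nonneg hδ
  have hαL : 0 ≤ α * L := mul_nonneg hα.1.le hL
  have hl : 1 ≤ Real.log (Real.exp 1 + L) := ElimTaS.one_le_log_exp_one_add hL
  have hD₀ : 0 < D₀ := hD
  set y : ℝ := α * L / D₀ + b / D₀ * Real.log (Real.exp 1 + L)
    + C * Real.sqrt (L * Real.log (Real.exp 1 + L)) with hy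
  have hynn : 0 ≤ y := by positivity
  set R := ElimTaS.concentrationTime M h₀ v X with hR
  set F : Set Ω := ⋃ i ∈ (Finset.univ : Finset H),
    {ω | ∃ n, α * L ≤ ElimTaS.llRatio M (X ω) n i h₀} with hF
  have hPF : P F ≤ Fintype.card H * ENNReal.ofReal (Real.exp (-(α * L))) := by
    refine (measure_biUnion_finset_le _ _).trans ((Finset.sum_le_sum fun i _ =>
      hX.measure_exists_le_llRatio hKL i (α * L)).trans (le_of_eq ?_))
    rw [Finset.sum_const, Finset.card_univ, nsmul_eq_mul]
  have hτ_le : ∀ (ω : Ω) (z : ℝ), 0 ≤ z → R ω ≠ ⊤ →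
      (∀ t : ℕ, (t : ℕ∞) < ElimTaS.stopTime M β (X ω) → (t : ℝ) ≤ z + C * (R ω).toReal) →
      (ElimTaS.stopTime M β (X ω) : ℝ≥0∞) ≤
        ENNReal.ofReal z + ENNReal.ofReal (C + 1) * R ω := by
    intro ω z hz hfin h
    have h1 := ElimTaS.one_le_toReal_concentrationTime hfin
    refine (ElimTaS.ENat_toENNReal_le_ofReal_add_one (by positivity) h).trans ?_
    rw [← ENNReal.ofReal_toReal hfin, ← ENNReal.ofReal_mul (by positivity),
      ← ENNReal.ofReal_add hz (by positivity), ENNReal.toReal_ofReal ENNReal.toReal_nonneg]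
    exact ENNReal.ofReal_le_ofReal (by linarith)
  -- Where `R` is infinite both bounds are vacuous, so its almost sure finiteness need not be
  -- invoked.
  have htop : ∀ ω (z : ℝ≥0∞), R ω = ⊤ → z + ENNReal.ofReal (C + 1) * R ω = ⊤ := by
    intro ω z h
    rw [h, ENNReal.mul_top (by simp; linarith), add_top]
  have h₁ : ∀ᵐ ω ∂P, ω ∉ F → (ElimTaS.stopTime M β (X ω) : ℝ≥0∞) ≤
      ENNReal.ofReal y + ENNReal.ofReal (C + 1) * R ω := by
    filter_upwards [hX.follows] with ω hω hωF
    by_cases hfin : R ω = ⊤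
    · rw [htop ω _ hfin]
      exact le_top
    · refine hτ_le ω y hynn hfin fun t ht => ?_
      refine (hbound α hα δ hδ η hη _ (ElimTaS.one_le_toReal_concentrationTime hfin) (X ω) hω
        (ElimTaS.concentratedFrom_toReal_concentrationTime hfin) t ht).2 fun i s => ?_
      by_contra hlt
      exact hωF (Set.mem_biUnion (Finset.mem_coe.2 (Finset.mem_univ i)) ⟨s, not_lt.1 hlt⟩)
  have h₂ : ∀ᵐ ω ∂P, (ElimTaS.stopTime M β (X ω) : ℝ≥0∞) ≤
      ENNReal.ofReal (C * (α * L)) + ENNReal.ofReal (C + 1) * R ω := by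
    filter_upwards [hX.follows] with ω hω
    by_cases hfin : R ω = ⊤
    · rw [htop ω _ hfin]
      exact le_top
    · exact hτ_le ω _ (by positivity) hfin fun t ht =>
        (hbound α hα δ hδ η hη _ (ElimTaS.one_le_toReal_concentrationTime hfin) (X ω) hω
          (ElimTaS.concentratedFrom_toReal_concentrationTime hfin) t ht).1
  refine (ElimTaS.lintegral_indicator_le_of_ae_le (E := E) (hX.measurable_concentrationTime v)
    (hX.lintegral_concentrationTime_le hKL hsub) hPF h₁ h₂).trans ?_
  have hexp : α * L * Real.exp (-(α * L)) ≤ 1 := by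
    rw [Real.exp_neg, ← div_eq_mul_inv, div_le_one (Real.exp_pos _)]
    linarith [Real.add_one_le_exp (α * L)]
  have hPE : P E = ENNReal.ofReal (P.real E) := (ofReal_measureReal (measure_ne_top P E)).symm
  rw [hPE, hρ',
    ← ENNReal.ofReal_natCast, ← ENNReal.ofReal_mul hynn,
    ← ENNReal.ofReal_mul (show 0 ≤ C + 1 by linarith), ← ENNReal.ofReal_mul (by positivity),
    ← ENNReal.ofReal_mul (by positivity), ← ENNReal.ofReal_add (by positivity) (by positivity),
    ← ENNReal.ofReal_add (by positivity) (by positivity)]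
  refine ENNReal.ofReal_le_ofReal ?_
  have e1 : C * (α * L) * (Fintype.card H * Real.exp (-(α * L))) ≤ C * Fintype.card H := by
    calc C * (α * L) * (Fintype.card H * Real.exp (-(α * L)))
        = C * Fintype.card H * (α * L * Real.exp (-(α * L))) := by ring
      _ ≤ C * Fintype.card H * 1 := by gcongr
      _ = _ := mul_one _
  have e2 : 0 ≤ P.real E * (1 * Real.log (Real.exp 1 + L) ^ 2) := by positivity
  nlinarith
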